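/- Let $p$ be a prime, let $F/\mathbb{Q}_p$ be a finite extension with ring of integers $\mathcal{O}_F$ and maximal ideal $\mathfrak{m}\subset\mathcal{O}_F$, let $F_0\subseteq F$ be the maximal subextension unramified over $\mathbb{Q}_p$, and let $\mathcal{O}_0$ be the ring of integers of $F_0$. For every integer $c\ge 0$ consider the subring $R_c:=\mathcal{O}_0+\mathfrak{m}^c\mathcal{O}_F$ of $F$. Suppose $\alpha\in K_2(F)$ is a divisible element, i.e. for every integer $n\ge 1$ there is $\beta\in K_2(F)$ with $\alpha=n\beta$. Then for every $c\ge 0$ the element $\alpha$ lies in the image of the map $K_2(R_c)\to K_2(F)$ induced by the inclusion $R_c\subset F$. Here $K_2(R)$ denotes the kernel of the canonical map $\operatorname{St}(R)\to\operatorname{GL}(R)$ from the stable Steinberg group of $R$. -/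

import Mathlib

/-! ### The Steinberg group and `K₂` of a commutative ring -/

/-- Generators `x i j r` (`i ≠ j`, `r ∈ R`) of the stable Steinberg group `St R`; the indices run
through `ℕ`. -/
structure SteinbergGen (R : Type*) where
  i : ℕ
  j : ℕ
  ne : i ≠ j
  r : R

/-- The generator `x i j r` as an element of the free group. -/
abbrev SteinbergGen.x {R : Type*} (i j : ℕ) (h : i ≠ j) (r : R) : FreeGroup (SteinbergGen R) :=
  FreeGroup.of ⟨i, j, h, r⟩

/-- The defining relators of the Steinberg group, where `⁅a, b⁆ = a * b * a⁻¹ * b⁻¹`: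
`x i j r * x i j s = x i j (r + s)`,
`⁅x i j r, x k l s⁆ = 1` for `j ≠ k`, `i ≠ l`, and
`⁅x i j r, x j l s⁆ = x i l (r * s)` for `i, j, l` pairwise distinct. -/
inductive SteinbergRel (R : Type*) [CommRing R] : FreeGroup (SteinbergGen R) → Prop
  | add (i j : ℕ) (h : i ≠ j) (r s : R) :
      SteinbergRel R (SteinbergGen.x i j h r * SteinbergGen.x i j h s *
        (SteinbergGen.x i j h (r + s))⁻¹)
  | comm_one (i j k l : ℕ) (h : i ≠ j) (h' : k ≠ l) (hjk : j ≠ k) (hil : i ≠ l) (r s : R) :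
      SteinbergRel R (SteinbergGen.x i j h r * SteinbergGen.x k l h' s *
        (SteinbergGen.x i j h r)⁻¹ * (SteinbergGen.x k l h' s)⁻¹)
  | comm_mul (i j l : ℕ) (h : i ≠ j) (h' : j ≠ l) (hil : i ≠ l) (r s : R) :
      SteinbergRel R (SteinbergGen.x i j h r * SteinbergGen.x j l h' s *
        (SteinbergGen.x i j h r)⁻¹ * (SteinbergGen.x j l h' s)⁻¹ * (SteinbergGen.x i l hil (r * s))⁻¹)

/-- The (stable) Steinberg group `St R`. -/
abbrev SteinbergGroup (R : Type*) [CommRing R] : Type _ :=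
  PresentedGroup {w | SteinbergRel R w}

/-- The elementary matrix `1 + r • E i j` (`i ≠ j`), as an automorphism `v ↦ v + (r * v j) • e i`
of the free module on the basis `e 0, e 1, …`. The stable group `GL R = ⋃ n, GL n R` acts
faithfully on this module, and the group generated by these automorphisms is `E R`. -/
noncomputable def elementaryMatrix {R : Type*} [CommRing R] (i j : ℕ) (h : i ≠ j) (r : R) :
    (ℕ →₀ R) ≃ₗ[R] (ℕ →₀ R) :=
  LinearEquiv.transvection (f := r • Finsupp.lapply j) (v := Finsupp.single i 1)
    (by simp [h])

theorem elementaryMatrix_apply {R : Type*} [CommRing R] (i j : ℕ) (h : i ≠ j) (r : R)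
    (v : ℕ →₀ R) :
    elementaryMatrix i j h r v = v + Finsupp.single i (r * v j) := by
  ext k
  simp [elementaryMatrix, LinearMap.transvection.apply, Finsupp.single_apply]

theorem elementaryMatrix_inv {R : Type*} [CommRing R] (i j : ℕ) (h : i ≠ j) (r : R) :
    (elementaryMatrix i j h r)⁻¹ = elementaryMatrix i j h (-r) := by
  rw [inv_eq_iff_mul_eq_one]
  ext1 v
  ext k
  simp [elementaryMatrix_apply, h]

/-- The canonical homomorphism `St R → E R ⊆ GL R` sending `x i j r` to `1 + r • E i j`. -/
noncomputable def SteinbergGroup.toElementary (R : Type*) [CommRing R] :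
    SteinbergGroup R →* ((ℕ →₀ R) ≃ₗ[R] (ℕ →₀ R)) :=
  PresentedGroup.toGroup (f := fun x : SteinbergGen R => elementaryMatrix x.i x.j x.ne x.r) (by
    intro w hw
    cases hw with
    | add i j h r s =>
      simp only [map_mul, map_inv, FreeGroup.lift_apply_of, mul_inv_eq_one]
      ext1 v
      ext k
      simp [elementaryMatrix_apply, h]
      ring
    | comm_one i j k l h h' hjk hil r s =>
      simp only [map_mul, map_inv, FreeGroup.lift_apply_of]
      rw [mul_inv_eq_one, mul_inv_eq_iff_eq_mul]
      ext1 v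
      simp [elementaryMatrix_apply, hjk.symm, hil, add_right_comm]
    | comm_mul i j l h h' hil r s =>
      simp only [map_mul, map_inv, FreeGroup.lift_apply_of]
      rw [mul_inv_eq_one, mul_inv_eq_iff_eq_mul, mul_inv_eq_iff_eq_mul]
      ext1 v
      ext k
      simp [elementaryMatrix_apply, h'.symm, hil.symm]
      ring)

/-- `K₂ R` is the kernel of `St R → GL R`, written multiplicatively. -/
noncomputable def K2 (R : Type*) [CommRing R] : Subgroup (SteinbergGroup R) :=
  (SteinbergGroup.toElementary R).ker

/-- The homomorphism `St R → St S`, `x i j r ↦ x i j (f r)`, induced by `f : R → S`. -/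
noncomputable def SteinbergGroup.map {R S : Type*} [CommRing R] [CommRing S] (f : R →+* S) :
    SteinbergGroup R →* SteinbergGroup S :=
  PresentedGroup.toGroup (f := fun x : SteinbergGen R => PresentedGroup.of ⟨x.i, x.j, x.ne, f x.r⟩) (by
    intro w hw
    cases hw with
    | add i j h r s =>
      simpa [PresentedGroup.of] using
        PresentedGroup.one_of_mem (rels := {w | SteinbergRel S w}) (SteinbergRel.add i j h (f r) (f s))
    | comm_one i j k l h h' hjk hil r s =>
      simpa [PresentedGroup.of] using
        PresentedGroup.one_of_mem (rels := {w | SteinbergRel S w}) (SteinbergRel.comm_one i j k l h h' hjk hil (f r) (f s))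
    | comm_mul i j l h h' hil r s =>
      simpa [PresentedGroup.of] using
        PresentedGroup.one_of_mem (rels := {w | SteinbergRel S w}) (SteinbergRel.comm_mul i j l h h' hil (f r) (f s)))

theorem SteinbergGroup.map_mem_K2 {R S : Type*} [CommRing R] [CommRing S] (f : R →+* S)
    {x : SteinbergGroup R} (hx : x ∈ K2 R) : SteinbergGroup.map f x ∈ K2 S := by
  have key : ∀ (x : SteinbergGroup R) (v : ℕ →₀ R),
      SteinbergGroup.toElementary S (SteinbergGroup.map f x)
          (v.mapRange f (map_zero f)) =
        (SteinbergGroup.toElementary R x v).mapRange f (map_zero f) := by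
    have hgen : ∀ (g : SteinbergGen R) (v : ℕ →₀ R),
        SteinbergGroup.toElementary S (SteinbergGroup.map f (PresentedGroup.of g))
            (v.mapRange f (map_zero f)) =
          (SteinbergGroup.toElementary R (PresentedGroup.of g) v).mapRange f (map_zero f) := by
      intro g v
      ext k
      simp [SteinbergGroup.toElementary, SteinbergGroup.map, elementaryMatrix_apply,
        Finsupp.single_apply, apply_ite f]
    intro x
    have hx : x ∈ Subgroup.closure (Set.range (PresentedGroup.of (rels := {w | SteinbergRel R w}))) := by
      rw [PresentedGroup.closure_range_of]; trivial
    induction hx using Subgroup.closure_induction with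
    | mem x hx => obtain ⟨g, rfl⟩ := hx; exact hgen g
    | one => intro v; simp
    | mul x y _ _ hx hy => intro v; simp [hx, hy]
    | inv x _ hx =>
      intro v
      have := hx ((SteinbergGroup.toElementary R x)⁻¹ v)
      simp only [map_inv]
      rw [LinearEquiv.coe_inv, LinearEquiv.symm_apply_eq, this]
      simp
  have hx' : SteinbergGroup.toElementary R x = 1 := hx
  change SteinbergGroup.toElementary S (SteinbergGroup.map f x) = 1
  ext1 w
  induction w using Finsupp.induction_linear with
  | zero => simp
  | add a b ha hb => simp [ha, hb]
  | single i s =>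
    have h1 := key x (Finsupp.single i 1)
    rw [hx'] at h1
    have h2 := congrArg (fun w => s • w) h1
    simpa [← map_smul] using h2

/-- The homomorphism `K₂ R → K₂ S` induced by a ring homomorphism `R → S`. -/
noncomputable def K2.map {R S : Type*} [CommRing R] [CommRing S] (f : R →+* S) :
    K2 R →* K2 S :=
  ((SteinbergGroup.map f).comp (K2 R).subtype).codRestrict (K2 S)
    fun x => SteinbergGroup.map_mem_K2 f x.2

/-- `a` is a divisible element of the (multiplicatively written) group `G`: for every `n ≥ 1` it
is an `n`-th power in `G`. -/
def IsDivisibleElement {G : Type*} [Group G] (a : G) : Prop :=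
  ∀ n : ℕ, 1 ≤ n → ∃ b : G, b ^ n = a

/-! ### Finite extensions of `ℚ_[p]` and the rings `R_c` -/

namespace LocalOrder

variable (p : ℕ) [Fact p.Prime] (F : Type*) [Field F] [Algebra ℚ_[p] F] [Algebra ℤ_[p] F]
  [IsScalarTower ℤ_[p] ℚ_[p] F]

/-- The ring of integers `𝒪_F`: the integral closure of `ℤ_[p]` in `F`. -/
noncomputable abbrev ringOfIntegers : Subalgebra ℤ_[p] F := integralClosure ℤ_[p] F

theorem isIntegral_iff_spectralNorm_le_one [FiniteDimensional ℚ_[p] F] (x : F) :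
    IsIntegral ℤ_[p] x ↔ spectralNorm ℚ_[p] F x ≤ 1 := by
  have hx : IsIntegral ℚ_[p] x := Algebra.IsIntegral.isIntegral x
  rw [spectralNorm, spectralValue_le_one_iff (minpoly.monic hx)]
  constructor
  · intro h n
    rw [minpoly.isIntegrallyClosed_eq_field_fractions' ℚ_[p] h, Polynomial.coeff_map]
    exact ((minpoly ℤ_[p] x).coeff n).2
  · intro h
    have hl : minpoly ℚ_[p] x ∈ Polynomial.lifts (algebraMap ℤ_[p] ℚ_[p]) := by
      rw [Polynomial.lifts_iff_coeff_lifts]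
      exact fun n => ⟨⟨_, h n⟩, rfl⟩
    obtain ⟨q, hq, -, hm⟩ := Polynomial.lifts_and_natDegree_eq_and_monic hl (minpoly.monic hx)
    refine ⟨q, hm, ?_⟩
    rw [← Polynomial.aeval_def, ← Polynomial.aeval_map_algebraMap ℚ_[p], hq, minpoly.aeval]

instance [FiniteDimensional ℚ_[p] F] : IsLocalRing (ringOfIntegers p F) := by
  have hN : ∀ x : ringOfIntegers p F, spectralNorm ℚ_[p] F (x : F) ≤ 1 := fun x =>
    (isIntegral_iff_spectralNorm_le_one p F _).1 x.2
  have hmul : ∀ x y : F, spectralNorm ℚ_[p] F (x * y) =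
      spectralNorm ℚ_[p] F x * spectralNorm ℚ_[p] F y := fun x y =>
    map_mul (spectralMulAlgNorm ℚ_[p] F) x y
  have h1 : spectralNorm ℚ_[p] F 1 = 1 := spectralNorm_one
  have hunit : ∀ x : ringOfIntegers p F, IsUnit x ↔ spectralNorm ℚ_[p] F (x : F) = 1 := by
    intro x
    constructor
    · rintro ⟨u, rfl⟩
      have hu : ((u : ringOfIntegers p F) : F) * ((u⁻¹ : (ringOfIntegers p F)ˣ) :
          ringOfIntegers p F) = 1 := by
        exact_mod_cast congrArg Subtype.val u.mul_inv
      have := hmul _ _ |>.symm.trans ((congrArg (spectralNorm ℚ_[p] F) hu).trans h1)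
      have ha := hN (u : ringOfIntegers p F)
      have hb := hN ((u⁻¹ : (ringOfIntegers p F)ˣ) : ringOfIntegers p F)
      have hc := spectralNorm_nonneg (K := ℚ_[p]) (L := F) ((u : ringOfIntegers p F) : F)
      nlinarith
    · intro hx
      have hx0 : (x : F) ≠ 0 := by
        intro h0
        rw [h0, spectralNorm_zero] at hx
        exact zero_ne_one hx
      have hinv : spectralNorm ℚ_[p] F ((x : F)⁻¹) ≤ 1 := by
        have := hmul (x : F) (x : F)⁻¹
        rw [mul_inv_cancel₀ hx0, h1, hx, one_mul] at this
        exact this.ge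
      exact IsUnit.of_mul_eq_one
        (⟨(x : F)⁻¹, (isIntegral_iff_spectralNorm_le_one p F _).2 hinv⟩ : ringOfIntegers p F)
        (Subtype.ext (mul_inv_cancel₀ hx0))
  refine IsLocalRing.of_nonunits_add fun a b ha hb => ?_
  rw [mem_nonunits_iff, hunit] at *
  have ha' := lt_of_le_of_ne (hN a) ha
  have hb' := lt_of_le_of_ne (hN b) hb
  have := isNonarchimedean_spectralNorm (K := ℚ_[p]) (L := F) (a : F) (b : F)
  exact (lt_of_le_of_lt this (max_lt ha' hb')).ne

/-- An intermediate field `E` is unramified over `ℚ_[p]` if `𝒪_E` is unramified over `ℤ_[p]`. -/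
def IsUnramified (E : IntermediateField ℚ_[p] F) : Prop :=
  Algebra.FormallyUnramified ℤ_[p] (ringOfIntegers p E)

/-- The maximal unramified subextension `F₀` of `F / ℚ_[p]`: the compositum of all unramified
subextensions. -/
noncomputable def maximalUnramified : IntermediateField ℚ_[p] F :=
  sSup {E | IsUnramified p F E}

/-- The inclusion `𝒪_0 → 𝒪_F` of the ring of integers `𝒪_0` of `F₀`. -/
noncomputable def inclusionO0 : ringOfIntegers p (maximalUnramified p F) →ₐ[ℤ_[p]] ringOfIntegers p F :=
  ((maximalUnramified p F).val.restrictScalars ℤ_[p]).mapIntegralClosure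

/-- The subring `R_c = 𝒪_0 + 𝔪 ^ c` of `F`, where `𝔪` is the maximal ideal of `𝒪_F`. -/
noncomputable def R [FiniteDimensional ℚ_[p] F] (c : ℕ) : Subring F where
  carrier := {x | ∃ a : ringOfIntegers p (maximalUnramified p F),
    ∃ b ∈ IsLocalRing.maximalIdeal (ringOfIntegers p F) ^ c,
      x = (inclusionO0 p F a : F) + (b : F)}
  one_mem' := ⟨1, 0, Ideal.zero_mem _, by simp⟩
  zero_mem' := ⟨0, 0, Ideal.zero_mem _, by simp⟩
  add_mem' := by
    rintro _ _ ⟨a, b, hb, rfl⟩ ⟨a', b', hb', rfl⟩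
    exact ⟨a + a', b + b', Ideal.add_mem _ hb hb', by simp; ring⟩
  neg_mem' := by
    rintro _ ⟨a, b, hb, rfl⟩
    exact ⟨-a, -b, neg_mem hb, by simp; ring⟩
  mul_mem' := by
    rintro _ _ ⟨a, b, hb, rfl⟩ ⟨a', b', hb', rfl⟩
    refine ⟨a * a', inclusionO0 p F a * b' + b * (inclusionO0 p F a' + b'),
      Ideal.add_mem _ (Ideal.mul_mem_left _ _ hb') (Ideal.mul_mem_right _ _ hb), ?_⟩
    simp
    ring

end LocalOrder

/-! It suffices to find one `n ≥ 1` such that every `n`-th power in `K₂ F` comes from `A = R_c`;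
divisibility of `α` by this `n` then finishes. All that matters about `A` is that it contains `𝔪 ^
c`.

`K₂` of a field is generated by the symbols `{u, v}` (`K2_eq_symbols`). These are central, bilinear
and antisymmetric, so it is enough to treat `{u, v} ^ n` for `u`, `v` among a uniformizer `π` and
the units of `𝒪_F`. The bridge to `A` is the Dennis–Stein element of `a`, `b` with `d = 1 - a * b`:
it makes sense in `K₂ A` as soon as `a, b ∈ A` and `d` is a unit of `A`, and in `K₂ F` it becomes
`{b⁻¹, d}` once `b ≠ 0` (`dennisStein_eq_symb`).

If `d ∈ 1 + 𝔪 ^ (2c+1)` and `b` has valuation `c` or `c + 1`, then `a = (1 - d) / b` has valuation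
at least `c`, so `a, b ∈ 𝔪 ^ c ⊆ A`. Such `b` generate `Fˣ`, hence `{y, d}` comes from `A` for all
`y` (`symb_mem_subringImage_of_sub_one_mem`). As `𝒪_F / 𝔪 ^ (2c+1)` is finite, some even `n` has `w
^ n ∈ 1 + 𝔪 ^ (2c+1)` for all units `w`. Then `{y, w} ^ n = {y, w ^ n}` comes from `A`, and `{π, π}
^ n = 1` because `{π, π} ^ 2 = 1`.

Generation by symbols follows from a Bruhat-type decomposition of `St` with two double cosets, by
induction on the matrix size. -/

namespace SteinbergGroup

open scoped commutatorElement

/-! ### Generators and relations in the Steinberg group of a commutative ring -/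

section Ring

variable {R : Type*} [CommRing R]

/-- The generator `x i j r` of the Steinberg group, with the junk value `1` if `i = j`. -/
noncomputable def elem (i j : ℕ) (r : R) : SteinbergGroup R :=
  if h : i ≠ j then PresentedGroup.of ⟨i, j, h, r⟩ else 1

theorem elem_of_ne {i j : ℕ} (h : i ≠ j) (r : R) : elem i j r = PresentedGroup.of ⟨i, j, h, r⟩ :=
  dif_pos h

@[simp] theorem elem_self (i : ℕ) (r : R) : elem i i r = 1 := by simp [elem]

theorem elem_mul_elem (i j : ℕ) (r s : R) : elem i j r * elem i j s = elem i j (r + s) := by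
  by_cases h : i ≠ j
  · have := PresentedGroup.one_of_mem (rels := {w | SteinbergRel R w}) (SteinbergRel.add i j h r s)
    rw [map_mul, map_mul, map_inv, mul_inv_eq_one] at this
    rw [elem_of_ne h, elem_of_ne h, elem_of_ne h]
    exact this
  · simp [elem, h]

@[simp] theorem elem_zero (i j : ℕ) : elem i j (0 : R) = 1 := by
  have := elem_mul_elem i j (0 : R) 0
  rwa [add_zero, mul_eq_left] at this

theorem elem_inv (i j : ℕ) (r : R) : (elem i j r)⁻¹ = elem i j (-r) := by
  rw [inv_eq_iff_mul_eq_one, elem_mul_elem, add_neg_cancel, elem_zero]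

theorem elem_commute {i j k l : ℕ} (hjk : j ≠ k) (hil : i ≠ l) (r s : R) :
    Commute (elem i j r) (elem k l s) := by
  by_cases h : i ≠ j
  · by_cases h' : k ≠ l
    · have := PresentedGroup.one_of_mem (rels := {w | SteinbergRel R w})
        (SteinbergRel.comm_one i j k l h h' hjk hil r s)
      rw [map_mul, map_mul, map_mul, map_inv, map_inv, mul_inv_eq_one, mul_inv_eq_iff_eq_mul]
        at this
      rw [elem_of_ne h, elem_of_ne h']
      exact this
    · simp [elem, h']
  · simp [elem, h]

theorem elem_commutator {i j l : ℕ} (hij : i ≠ j) (hjl : j ≠ l) (hil : i ≠ l) (r s : R) :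
    ⁅elem i j r, elem j l s⁆ = elem i l (r * s) := by
  have := PresentedGroup.one_of_mem (rels := {w | SteinbergRel R w})
    (SteinbergRel.comm_mul i j l hij hjl hil r s)
  rw [map_mul, map_mul, map_mul, map_mul, map_inv, map_inv, map_inv, mul_inv_eq_one] at this
  rw [commutatorElement_def, elem_of_ne hij, elem_of_ne hjl, elem_of_ne hil]
  exact this

theorem elem_conj_right {i j l : ℕ} (hij : i ≠ j) (hjl : j ≠ l) (hil : i ≠ l) (r s : R) :
    elem i j r * elem j l s * (elem i j r)⁻¹ = elem i l (r * s) * elem j l s := by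
  rw [← elem_commutator hij hjl hil, commutatorElement_def]
  group

theorem elem_conj_left {i j l : ℕ} (hij : i ≠ j) (hjl : j ≠ l) (hil : i ≠ l) (r s : R) :
    elem j l s * elem i j r * (elem j l s)⁻¹ = elem i l (-(r * s)) * elem i j r := by
  rw [← elem_inv, ← elem_commutator hij hjl hil, commutatorElement_def]
  group

theorem toElementary_elem {i j : ℕ} (h : i ≠ j) (r : R) (v : ℕ →₀ R) :
    toElementary R (elem i j r) v = v + Finsupp.single i (r * v j) := by
  rw [elem_of_ne h, toElementary, PresentedGroup.toGroup.of, elementaryMatrix_apply]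

@[simp] theorem map_elem {S : Type*} [CommRing S] (f : R →+* S) (i j : ℕ) (r : R) :
    map f (elem i j r) = elem i j (f r) := by
  by_cases h : i ≠ j
  · rw [elem_of_ne h, elem_of_ne h, map, PresentedGroup.toGroup.of]
  · simp [elem, h]

/-! ### Subgroups generated by families of generators -/

/-- The subgroup generated by the `x i j r` with `I i j`. -/
def gen (R : Type*) [CommRing R] (I : ℕ → ℕ → Prop) : Subgroup (SteinbergGroup R) :=
  Subgroup.closure {g | ∃ i j r, I i j ∧ g = elem i j r}

theorem elem_mem_gen {I : ℕ → ℕ → Prop} {i j : ℕ} (h : I i j) (r : R) : elem i j r ∈ gen R I :=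
  Subgroup.subset_closure ⟨i, j, r, h, rfl⟩

theorem gen_mono {I J : ℕ → ℕ → Prop} (h : ∀ i j, I i j → J i j) : gen R I ≤ gen R J :=
  Subgroup.closure_mono fun _ ⟨i, j, r, hij, e⟩ => ⟨i, j, r, h i j hij, e⟩

@[elab_as_elim]
theorem gen_induction_left {I : ℕ → ℕ → Prop} {p : SteinbergGroup R → Prop}
    {g : SteinbergGroup R} (hg : g ∈ gen R I) (one : p 1)
    (mul : ∀ i j r g, I i j → i ≠ j → p g → p (elem i j r * g)) : p g := by
  have mul' : ∀ i j r g, I i j → p g → p (elem i j r * g) := by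
    intro i j r g hI hp
    by_cases h : i = j
    · subst h; simpa using hp
    · exact mul i j r g hI h hp
  induction hg using Subgroup.closure_induction_left with
  | one => exact one
  | mul_left x hx y _ ih =>
    obtain ⟨i, j, r, h, rfl⟩ := hx
    exact mul' i j r y h ih
  | inv_mul_cancel x hx y _ ih =>
    obtain ⟨i, j, r, h, rfl⟩ := hx
    rw [elem_inv]
    exact mul' i j (-r) y h ih

theorem gen_le {I : ℕ → ℕ → Prop} {H : Subgroup (SteinbergGroup R)}
    (h : ∀ i j r, I i j → i ≠ j → elem i j r ∈ H) : gen R I ≤ H := fun _ hg =>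
  gen_induction_left hg H.one_mem (fun i j r _ hI hij ih => H.mul_mem (h i j r hI hij) ih)

theorem gen_conj {I J : ℕ → ℕ → Prop}
    (h : ∀ i j k l (r s : R), I i j → i ≠ j → J k l → k ≠ l →
      elem i j r * elem k l s * (elem i j r)⁻¹ ∈ gen R J)
    {g x : SteinbergGroup R} (hg : g ∈ gen R I) (hx : x ∈ gen R J) : g * x * g⁻¹ ∈ gen R J := by
  revert x
  refine gen_induction_left (p := fun g => ∀ {x}, x ∈ gen R J → g * x * g⁻¹ ∈ gen R J) hg ?_ ?_
  · simp
  · intro i j r g hI hij ih x hx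
    have key : ∀ y ∈ gen R J, elem i j r * y * (elem i j r)⁻¹ ∈ gen R J := by
      intro y hy
      refine gen_induction_left hy (by simp) ?_
      intro k l s y hJ hkl ih
      have := mul_mem (h i j k l r s hI hij hJ hkl) ih
      rwa [conj_mul] at this
    have := key _ (ih hx)
    simpa [mul_assoc] using this

/-- Any given element involves finitely many indices, so a fresh index is always available. -/
theorem exists_mem_gen (g : SteinbergGroup R) : ∃ n, g ∈ gen R (fun i j => i < n ∧ j < n) := by
  have hg : g ∈ Subgroup.closure
      (Set.range (PresentedGroup.of (rels := {w | SteinbergRel R w}))) := by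
    rw [PresentedGroup.closure_range_of]; trivial
  induction hg using Subgroup.closure_induction with
  | mem x hx =>
    obtain ⟨⟨i, j, h, r⟩, rfl⟩ := hx
    refine ⟨max i j + 1, ?_⟩
    rw [← elem_of_ne h]
    exact elem_mem_gen ⟨by omega, by omega⟩ r
  | one => exact ⟨0, one_mem _⟩
  | mul x y _ _ hx hy =>
    obtain ⟨n, hn⟩ := hx
    obtain ⟨m, hm⟩ := hy
    exact ⟨max n m, mul_mem (gen_mono (fun i j h => by omega) hn)
      (gen_mono (fun i j h => by omega) hm)⟩
  | inv x _ hx =>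
    obtain ⟨n, hn⟩ := hx
    exact ⟨n, inv_mem hn⟩

/-! ### Row and column subgroups -/

/-- The subgroup generated by the `x i n r` with `i ∈ T`. -/
abbrev column (R : Type*) [CommRing R] (n : ℕ) (T : Finset ℕ) : Subgroup (SteinbergGroup R) :=
  gen R (fun i j => i ∈ T ∧ j = n)

/-- The subgroup generated by the `x n j r` with `j ∈ T`. -/
abbrev row (R : Type*) [CommRing R] (n : ℕ) (T : Finset ℕ) : Subgroup (SteinbergGroup R) :=
  gen R (fun i j => i = n ∧ j ∈ T)

theorem column_insert {n m : ℕ} {T : Finset ℕ} (hm : m ≠ n) (hT : n ∉ T) {g : SteinbergGroup R}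
    (hg : g ∈ column R n (insert m T)) : ∃ c ∈ column R n T, ∃ r, g = c * elem m n r := by
  refine gen_induction_left hg ⟨1, one_mem _, 0, by simp⟩ ?_
  rintro i j r g ⟨hi, rfl⟩ hij ⟨c, hc, s, rfl⟩
  rw [Finset.mem_insert] at hi
  rcases hi with rfl | hi
  · refine ⟨c, hc, r + s, ?_⟩
    have : Commute (elem i j r) c := by
      refine gen_induction_left hc (Commute.one_right _) ?_
      rintro k l t g ⟨hk, rfl⟩ hkl ih
      exact (elem_commute (by rintro rfl; exact hT hk) hm r t).mul_right ih
    rw [← mul_assoc, this.eq, mul_assoc, elem_mul_elem]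
  · exact ⟨elem i j r * c, mul_mem (elem_mem_gen ⟨hi, rfl⟩ r) hc, s, by rw [mul_assoc]⟩

theorem row_insert {n m : ℕ} {T : Finset ℕ} (hm : m ≠ n) (hT : n ∉ T) {g : SteinbergGroup R}
    (hg : g ∈ row R n (insert m T)) : ∃ r, ∃ c ∈ row R n T, g = elem n m r * c := by
  refine gen_induction_left hg ⟨0, 1, one_mem _, by simp⟩ ?_
  rintro i j r g ⟨rfl, hj⟩ hij ⟨s, c, hc, rfl⟩
  rw [Finset.mem_insert] at hj
  rcases hj with rfl | hj
  · exact ⟨r + s, c, hc, by rw [← mul_assoc, elem_mul_elem]⟩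
  · refine ⟨s, elem i j r * c, mul_mem (elem_mem_gen ⟨rfl, hj⟩ r) hc, ?_⟩
    rw [← mul_assoc, ← mul_assoc, (elem_commute (Ne.symm hij) hm.symm r s).eq]

theorem toElementary_column_apply {n k : ℕ} {T : Finset ℕ} (hT : n ∉ T) (hk : k ∉ T)
    {g : SteinbergGroup R} (hg : g ∈ column R n T) (v : ℕ →₀ R) :
    toElementary R g v k = v k := by
  refine gen_induction_left hg (by simp) ?_
  rintro i j r g ⟨hi, rfl⟩ hij ih
  have : i ≠ k := by rintro rfl; exact hk hi
  simp [toElementary_elem hij, this, ih]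

/-- A column subgroup embeds in `GL`: its factors commute, and each coefficient can be read off from
the `n`-th column of the matrix. Equalities inside it may thus be checked on matrices.
`eq_one_of_mem_row` is the transpose. -/
theorem eq_one_of_mem_column {n : ℕ} {T : Finset ℕ} (hT : n ∉ T) {g : SteinbergGroup R}
    (hg : g ∈ column R n T)
    (h : toElementary R g (Finsupp.single n 1) = Finsupp.single n 1) : g = 1 := by
  induction T using Finset.induction_on generalizing g with
  | empty => exact gen_induction_left hg (by simp) (by simp)
  | insert m T hm ih =>
    have hmn : m ≠ n := by rintro rfl; simp at hT
    have hT' : n ∉ T := fun h => hT (Finset.mem_insert_of_mem h)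
    obtain ⟨c, hc, r, rfl⟩ := column_insert hmn hT' hg
    have h1 := DFunLike.congr_fun h m
    rw [map_mul, LinearEquiv.mul_apply, toElementary_column_apply hT' hm hc,
      toElementary_elem hmn] at h1
    obtain rfl : r = 0 := by simpa [hmn.symm] using h1
    rw [elem_zero, mul_one] at h ⊢
    exact ih hT' hc h

theorem toElementary_row_single {n k : ℕ} {T : Finset ℕ} (hT : n ∉ T) (hk : k ∉ T)
    {g : SteinbergGroup R} (hg : g ∈ row R n T) :
    toElementary R g (Finsupp.single k 1) = Finsupp.single k 1 := by
  refine gen_induction_left hg (by simp) ?_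
  rintro i j r g ⟨rfl, hj⟩ hij ih
  have : k ≠ j := by rintro rfl; exact hk hj
  simp [toElementary_elem hij, this, ih]

theorem eq_one_of_mem_row {n : ℕ} {T : Finset ℕ} (hT : n ∉ T) {g : SteinbergGroup R}
    (hg : g ∈ row R n T)
    (h : ∀ j ∈ T, toElementary R g (Finsupp.single j 1) n = 0) : g = 1 := by
  induction T using Finset.induction_on generalizing g with
  | empty => exact gen_induction_left hg (by simp) (by simp)
  | insert m T hm ih =>
    have hmn : m ≠ n := by rintro rfl; simp at hT
    have hT' : n ∉ T := fun h => hT (Finset.mem_insert_of_mem h)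
    obtain ⟨r, c, hc, rfl⟩ := row_insert hmn hT' hg
    have h1 := h m (Finset.mem_insert_self _ _)
    rw [map_mul, LinearEquiv.mul_apply, toElementary_row_single hT' hm hc,
      toElementary_elem hmn.symm] at h1
    obtain rfl : r = 0 := by simpa [hmn] using h1
    rw [elem_zero, one_mul] at h ⊢
    exact ih hT' hc fun j hj => h j (Finset.mem_insert_of_mem hj)

theorem conj_mem_column {n : ℕ} {g x : SteinbergGroup R}
    (hg : g ∈ gen R (fun i j => i < n ∧ j < n)) (hx : x ∈ column R n (Finset.range n)) :
    g * x * g⁻¹ ∈ column R n (Finset.range n) := by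
  refine gen_conj ?_ hg hx
  rintro i j k l r s ⟨hi, hj⟩ hij ⟨hk, rfl⟩ hkl
  by_cases hjk : j = k
  · subst hjk
    rw [elem_conj_right hij hkl hi.ne]
    exact mul_mem (elem_mem_gen ⟨by simpa, rfl⟩ _) (elem_mem_gen ⟨hk, rfl⟩ _)
  · rw [(elem_commute hjk hi.ne r s).eq, mul_inv_cancel_right]
    exact elem_mem_gen ⟨hk, rfl⟩ _

theorem conj_mem_row {n : ℕ} {g x : SteinbergGroup R}
    (hg : g ∈ gen R (fun i j => i < n ∧ j < n)) (hx : x ∈ row R n (Finset.range n)) :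
    g * x * g⁻¹ ∈ row R n (Finset.range n) := by
  refine gen_conj ?_ hg hx
  rintro i j k l r s ⟨hi, hj⟩ hij ⟨rfl, hl⟩ hkl
  by_cases hil : i = l
  · subst hil
    rw [elem_conj_left hkl hij hj.ne']
    exact mul_mem (elem_mem_gen ⟨rfl, by simpa⟩ _) (elem_mem_gen ⟨rfl, hl⟩ _)
  · rw [(elem_commute hj.ne hil r s).eq, mul_inv_cancel_right]
    exact elem_mem_gen ⟨rfl, hl⟩ _

/-! ### Centrality of `K₂` -/

/-- If `c ∈ K₂` only involves indices below `N`, conjugation by `c` preserves the `N`-th column and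
row subgroups. These embed in `GL`, where `c` is trivial, so `c` commutes with every `x i N r` and
`x N j s` with `i, j < N`, hence with their commutators `x i j (r * s)`. -/
theorem K2_le_center : K2 R ≤ Subgroup.center (SteinbergGroup R) := by
  intro c hc
  have hc' : toElementary R c = 1 := hc
  obtain ⟨n, hn⟩ := exists_mem_gen c
  have hcol : ∀ N ≥ n, ∀ i < N, ∀ r : R, c * elem i N r = elem i N r * c := by
    intro N hN i hi r
    have hcN : c ∈ gen R (fun i j => i < N ∧ j < N) := gen_mono (fun i j h => by omega) hn
    have hx : elem i N r ∈ column R N (Finset.range N) := elem_mem_gen ⟨by simpa, rfl⟩ r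
    have h1 : c * elem i N r * c⁻¹ * (elem i N r)⁻¹ = 1 := by
      refine eq_one_of_mem_column (by simp) (mul_mem (conj_mem_column hcN hx) (inv_mem hx)) ?_
      simp [hc']
    rwa [mul_inv_eq_one, mul_inv_eq_iff_eq_mul] at h1
  have hrow : ∀ N ≥ n, ∀ i < N, ∀ r : R, c * elem N i r = elem N i r * c := by
    intro N hN i hi r
    have hcN : c ∈ gen R (fun i j => i < N ∧ j < N) := gen_mono (fun i j h => by omega) hn
    have hx : elem N i r ∈ row R N (Finset.range N) := elem_mem_gen ⟨rfl, by simpa⟩ r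
    have h1 : c * elem N i r * c⁻¹ * (elem N i r)⁻¹ = 1 := by
      refine eq_one_of_mem_row (by simp) (mul_mem (conj_mem_row hcN hx) (inv_mem hx)) ?_
      intro j hj
      have : j ≠ N := by rintro rfl; simp at hj
      simp [hc', this]
    rwa [mul_inv_eq_one, mul_inv_eq_iff_eq_mul] at h1
  rw [Subgroup.mem_center_iff]
  intro g
  obtain ⟨m, hm⟩ := exists_mem_gen g
  have hle : gen R (fun i j => i < m ∧ j < m) ≤ Subgroup.centralizer {c} := by
    refine gen_le fun i j r hI hij => ?_
    obtain ⟨hi, hj⟩ := hI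
    rw [Subgroup.mem_centralizer_singleton_iff]
    -- The index `max m n` lies beyond all those occurring in `c` and in `g`.
    have h1 : Commute c (elem i (max m n) r) := hcol _ (le_max_right _ _) i (by omega) r
    have h2 : Commute c (elem (max m n) j 1) := hrow _ (le_max_right _ _) j (by omega) 1
    have h3 := elem_commutator (i := i) (j := max m n) (l := j) (by omega) (by omega) hij r 1
    rw [mul_one] at h3
    have h4 : Commute c (elem i j r) := by
      rw [← h3, commutatorElement_def]
      exact ((h1.mul_right h2).mul_right h1.inv_right).mul_right h2.inv_right
    exact h4.eq.symm
  exact Subgroup.mem_centralizer_singleton_iff.1 (hle hm)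

theorem K2_commute {z : SteinbergGroup R} (hz : toElementary R z = 1) (g : SteinbergGroup R) :
    Commute z g :=
  (Subgroup.mem_center_iff.1 (K2_le_center (show z ∈ K2 R from hz)) g).symm

theorem commutator_mul_left_of_commute {G : Type*} [Group G] {z a b : G} (h : ∀ g, Commute z g) :
    ⁅z * a, b⁆ = ⁅a, b⁆ := by
  have : ⁅z * a, b⁆ = z * (a * b * a⁻¹) * z⁻¹ * b⁻¹ := by rw [commutatorElement_def]; group
  rw [this, (h _).eq, mul_inv_cancel_right, commutatorElement_def]

/-- Since the kernel `K₂` is central, a commutator in `St` depends only on the matrices of its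
entries. This lifts matrix identities to `St`. -/
theorem commutator_congr {a a' b b' : SteinbergGroup R}
    (ha : toElementary R a = toElementary R a') (hb : toElementary R b = toElementary R b') :
    ⁅a, b⁆ = ⁅a', b'⁆ := by
  have h1 : ∀ a a' b : SteinbergGroup R, toElementary R a = toElementary R a' →
      ⁅a, b⁆ = ⁅a', b⁆ := by
    intro a a' b h
    have hz : toElementary R (a * a'⁻¹) = 1 := by simp [h]
    have := commutator_mul_left_of_commute (a := a') (b := b) (K2_commute hz)
    rwa [inv_mul_cancel_right] at this
  rw [h1 a a' b ha, ← commutatorElement_inv, h1 b b' a' hb, commutatorElement_inv]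

/-! ### Monomial elements -/

/-- The matrix of `g` has the unit `a` at position `(i', i)`, and zeros elsewhere in its column `i`
and its row `i'`. -/
def IsMonomialAt (g : SteinbergGroup R) (i i' : ℕ) (a : Rˣ) : Prop :=
  toElementary R g (Finsupp.single i 1) = Finsupp.single i' (a : R) ∧
    ∀ v, toElementary R g v i' = a * v i

theorem IsMonomialAt.map_single {g : SteinbergGroup R} {i i' : ℕ} {a : Rˣ}
    (h : IsMonomialAt g i i' a) (r : R) :
    toElementary R g (Finsupp.single i r) = Finsupp.single i' (a * r) := by
  have := congrArg (fun v => r • v) h.1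
  simpa [← map_smul, mul_comm] using this

theorem IsMonomialAt.mul {g g' : SteinbergGroup R} {i i' i'' : ℕ} {a b : Rˣ}
    (h' : IsMonomialAt g' i' i'' b) (h : IsMonomialAt g i i' a) :
    IsMonomialAt (g' * g) i i'' (b * a) := by
  constructor
  · rw [map_mul, LinearEquiv.mul_apply, h.1, h'.map_single, Units.val_mul]
  · intro v
    rw [map_mul, LinearEquiv.mul_apply, h'.2, h.2, Units.val_mul, mul_assoc]

theorem toElementary_eq_of_isMonomialAt {g g' : SteinbergGroup R}
    (h : ∀ k, ∃ k' a, IsMonomialAt g k k' a ∧ IsMonomialAt g' k k' a) :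
    toElementary R g = toElementary R g' := by
  refine LinearEquiv.toLinearMap_injective (Finsupp.lhom_ext' fun k => LinearMap.ext_ring ?_)
  obtain ⟨k', a, h1, h2⟩ := h k
  exact h1.1.trans h2.1.symm

theorem toElementary_conj_elem {g : SteinbergGroup R} {i j i' j' : ℕ} {a b : Rˣ}
    (hij : i ≠ j) (hij' : i' ≠ j') (hi : IsMonomialAt g i i' a) (hj : IsMonomialAt g j j' b)
    (r : R) : toElementary R (g * elem i j r * g⁻¹) =
      toElementary R (elem i' j' (a * r * (b⁻¹ : Rˣ))) := by
  rw [map_mul, map_inv, mul_inv_eq_iff_eq_mul, map_mul]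
  ext1 v
  rw [LinearEquiv.mul_apply, LinearEquiv.mul_apply, toElementary_elem hij, toElementary_elem hij',
    map_add, hi.map_single, hj.2]
  congr 2
  have : (b⁻¹ : Rˣ) * (b : R) = 1 := b.inv_mul
  linear_combination (-(a * r * v j)) * this

/-- Conjugation by an element with monomial matrix. -/
theorem conj_elem {g : SteinbergGroup R} {i j k i' j' k' : ℕ} {a b c : Rˣ}
    (hi : IsMonomialAt g i i' a) (hj : IsMonomialAt g j j' b) (hk : IsMonomialAt g k k' c)
    (hij : i ≠ j) (hik : i ≠ k) (hjk : j ≠ k) (hij' : i' ≠ j') (hik' : i' ≠ k') (hjk' : j' ≠ k')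
    (r : R) : g * elem i j r * g⁻¹ = elem i' j' (a * r * (b⁻¹ : Rˣ)) := by
  -- The spare index `k` turns the generator into a commutator, for which a matrix computation
  -- suffices.
  have h1 : elem i j r = ⁅elem i k r, elem k j 1⁆ := by
    rw [elem_commutator hik hjk.symm hij, mul_one]
  have h2 : g * ⁅elem i k r, elem k j 1⁆ * g⁻¹ =
      ⁅g * elem i k r * g⁻¹, g * elem k j 1 * g⁻¹⁆ := by
    simp only [commutatorElement_def]
    group
  rw [h1, h2, commutator_congr (toElementary_conj_elem hik hik' hi hk r)
    (toElementary_conj_elem hjk.symm hjk'.symm hk hj 1), elem_commutator hik' hjk'.symm hij']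
  congr 1
  have : (c⁻¹ : Rˣ) * (c : R) = 1 := c.inv_mul
  linear_combination (a * r * (b⁻¹ : Rˣ) : R) * this

/-! ### The elements `w i j u` and `h i j u` -/

/-- `w i j u = x i j u * x j i (-u⁻¹) * x i j u`. -/
noncomputable def weyl (i j : ℕ) (u : Rˣ) : SteinbergGroup R :=
  elem i j (u : R) * elem j i (-(u⁻¹ : Rˣ) : R) * elem i j (u : R)

/-- `h i j u = w i j u * w i j (-1)`. -/
noncomputable def diag (i j : ℕ) (u : Rˣ) : SteinbergGroup R :=
  weyl i j u * weyl i j (-1)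

theorem weyl_inv (i j : ℕ) (u : Rˣ) : (weyl i j u)⁻¹ = weyl i j (-u) := by
  simp [weyl, elem_inv, mul_assoc, inv_neg]

theorem diag_one (i j : ℕ) : diag i j (1 : Rˣ) = 1 := by
  rw [diag, ← weyl_inv, mul_inv_cancel]

theorem toElementary_weyl {i j : ℕ} (h : i ≠ j) (u : Rˣ) (v : ℕ →₀ R) (k : ℕ) :
    toElementary R (weyl i j u) v k =
      if k = i then u * v j else if k = j then -(u⁻¹ : Rˣ) * v i else v k := by
  have hu : (u : R) * (u⁻¹ : Rˣ) = 1 := u.mul_inv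
  simp only [weyl, map_mul, LinearEquiv.mul_apply, toElementary_elem h, toElementary_elem h.symm,
    Finsupp.add_apply, Finsupp.single_apply]
  by_cases hi : k = i
  · subst hi
    simp [h, h.symm]
    linear_combination (-v k - u * v j) * hu
  by_cases hj : k = j
  · subst hj
    simp [h, h.symm]
    linear_combination (-v k) * hu
  · simp [hi, hj, Ne.symm hi, Ne.symm hj]

theorem isMonomialAt_weyl_left {i j : ℕ} (h : i ≠ j) (u : Rˣ) :
    IsMonomialAt (weyl i j u) i j (-u⁻¹) := by
  refine ⟨?_, fun v => by simp [toElementary_weyl h, h.symm]⟩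
  ext k
  rw [toElementary_weyl h]
  split_ifs <;> simp_all

theorem isMonomialAt_weyl_right {i j : ℕ} (h : i ≠ j) (u : Rˣ) :
    IsMonomialAt (weyl i j u) j i u := by
  refine ⟨?_, fun v => by simp [toElementary_weyl h]⟩
  ext k
  rw [toElementary_weyl h]
  split_ifs <;> simp_all

theorem isMonomialAt_weyl_of_ne {i j k : ℕ} (h : i ≠ j) (hi : k ≠ i) (hj : k ≠ j) (u : Rˣ) :
    IsMonomialAt (weyl i j u) k k 1 := by
  refine ⟨?_, fun v => by simp [toElementary_weyl h, hi, hj]⟩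
  ext l
  rw [toElementary_weyl h]
  split_ifs <;> simp_all [Finsupp.single_apply]

theorem isMonomialAt_diag_left {i j : ℕ} (h : i ≠ j) (u : Rˣ) :
    IsMonomialAt (diag i j u) i i u := by
  rw [diag]
  simpa using (isMonomialAt_weyl_right h u).mul (isMonomialAt_weyl_left h (-1))

theorem isMonomialAt_diag_right {i j : ℕ} (h : i ≠ j) (u : Rˣ) :
    IsMonomialAt (diag i j u) j j u⁻¹ := by
  rw [diag]
  simpa using (isMonomialAt_weyl_left h u).mul (isMonomialAt_weyl_right h (-1))

theorem isMonomialAt_diag_of_ne {i j k : ℕ} (h : i ≠ j) (hi : k ≠ i) (hj : k ≠ j) (u : Rˣ) :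
    IsMonomialAt (diag i j u) k k 1 := by
  rw [diag]
  simpa using (isMonomialAt_weyl_of_ne h hi hj u).mul (isMonomialAt_weyl_of_ne h hi hj (-1))

theorem conj_weyl {g : SteinbergGroup R} {i j k i' j' k' : ℕ} {a b c : Rˣ}
    (hi : IsMonomialAt g i i' a) (hj : IsMonomialAt g j j' b) (hk : IsMonomialAt g k k' c)
    (hij : i ≠ j) (hik : i ≠ k) (hjk : j ≠ k) (hij' : i' ≠ j') (hik' : i' ≠ k') (hjk' : j' ≠ k')
    (u : Rˣ) : g * weyl i j u * g⁻¹ = weyl i' j' (a * u * b⁻¹) := by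
  rw [weyl, ← conj_mul, ← conj_mul, conj_elem hi hj hk hij hik hjk hij' hik' hjk',
    conj_elem hj hi hk hij.symm hjk hik hij'.symm hjk' hik', weyl]
  congr 3
  simp
  ring

/-- Conjugating `w i j u` by itself changes nothing, while `conj_weyl` computes the result as `w j i
(-u⁻¹)`. -/
theorem weyl_swap {i j : ℕ} (h : i ≠ j) (u : Rˣ) : weyl i j u = weyl j i (-u⁻¹) := by
  have := conj_weyl (isMonomialAt_weyl_left h u) (isMonomialAt_weyl_right h u)
    (isMonomialAt_weyl_of_ne (k := i + j + 1) h (by omega) (by omega) u) h (by omega) (by omega)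
    h.symm (by omega) (by omega) u
  simpa using this

theorem diag_conj_elem {i j : ℕ} (h : i ≠ j) (u : Rˣ) (r : R) :
    diag i j u * elem i j r * (diag i j u)⁻¹ = elem i j (u * r * u) := by
  simpa using conj_elem (isMonomialAt_diag_left h u) (isMonomialAt_diag_right h u)
    (isMonomialAt_diag_of_ne (k := i + j + 1) h (by omega) (by omega) u) h (by omega) (by omega)
    h (by omega) (by omega) r

/-! ### Symbols -/

/-- The Steinberg symbol `{u, v} = h i j (u * v) * (h i j u)⁻¹ * (h i j v)⁻¹`. -/
noncomputable def symb (i j : ℕ) (u v : Rˣ) : SteinbergGroup R :=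
  diag i j (u * v) * (diag i j u)⁻¹ * (diag i j v)⁻¹

theorem toElementary_diag_mul {i j : ℕ} (h : i ≠ j) (u v : Rˣ) :
    toElementary R (diag i j (u * v)) = toElementary R (diag i j u * diag i j v) := by
  refine toElementary_eq_of_isMonomialAt fun k => ?_
  by_cases hi : k = i
  · subst hi
    exact ⟨_, _, isMonomialAt_diag_left h _,
      (isMonomialAt_diag_left h _).mul (isMonomialAt_diag_left h _)⟩
  by_cases hj : k = j
  · subst hj
    refine ⟨_, _, isMonomialAt_diag_right h _, ?_⟩
    simpa [mul_comm] using (isMonomialAt_diag_right h u).mul (isMonomialAt_diag_right h v)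
  · refine ⟨_, _, isMonomialAt_diag_of_ne h hi hj _, ?_⟩
    simpa using (isMonomialAt_diag_of_ne h hi hj u).mul (isMonomialAt_diag_of_ne h hi hj v)

theorem toElementary_symb {i j : ℕ} (h : i ≠ j) (u v : Rˣ) :
    toElementary R (symb i j u v) = 1 := by
  rw [symb, map_mul, map_inv, mul_inv_eq_one, map_mul, map_inv, mul_inv_eq_iff_eq_mul, ← map_mul,
    ← toElementary_diag_mul h, mul_comm]

theorem symb_commute {i j : ℕ} (h : i ≠ j) (u v : Rˣ) (g : SteinbergGroup R) :
    Commute (symb i j u v) g :=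
  K2_commute (toElementary_symb h u v) g

theorem diag_mul (i j : ℕ) (u v : Rˣ) :
    diag i j u * diag i j v = (symb i j v u)⁻¹ * diag i j (u * v) := by
  rw [eq_inv_mul_iff_mul_eq, symb, mul_comm v u]
  group

/-- Conjugation by `h i k u` sends `w i j t` to `w i j (u * t)`, hence `h i j v` to `h i j (u * v) *
(h i j u)⁻¹`. As a commutator, the symbol depends only on matrices, which yields bilinearity and
antisymmetry. -/
theorem commutator_diag {i j k : ℕ} (hij : i ≠ j) (hik : i ≠ k) (hjk : j ≠ k) (u v : Rˣ) :
    ⁅diag i k u, diag i j v⁆ = symb i j u v := by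
  have key := fun t => conj_weyl (isMonomialAt_diag_left hik u)
    (isMonomialAt_diag_of_ne hik hij.symm hjk u)
    (isMonomialAt_diag_of_ne (k := i + j + k + 1) hik (by omega) (by omega) u) hij (by omega)
    (by omega) hij (by omega) (by omega) t
  rw [commutatorElement_def, symb]
  congr 1
  rw [diag.eq_1 i j v, ← conj_mul, key, key, diag, diag, mul_inv_rev, weyl_inv, weyl_inv]
  simp [mul_assoc, ← weyl_inv]

theorem symb_mul_left {i j : ℕ} (h : i ≠ j) (u u' v : Rˣ) :
    symb i j (u * u') v = symb i j u v * symb i j u' v := by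
  have hik : i ≠ i + j + 1 := by omega
  have hjk : j ≠ i + j + 1 := by omega
  rw [← commutator_diag h hik hjk, commutator_congr (toElementary_diag_mul hik u u') rfl]
  have : ∀ a b c : SteinbergGroup R, ⁅a * b, c⁆ = a * ⁅b, c⁆ * a⁻¹ * ⁅a, c⁆ := by
    intro a b c
    simp only [commutatorElement_def]
    group
  rw [this, commutator_diag h hik hjk, commutator_diag h hik hjk, ← (symb_commute h u' v _).eq,
    mul_inv_cancel_right, (symb_commute h _ _ _).eq]

/-- The symbol is central, so conjugation by `w j k 1` fixes it. On matrices this conjugation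
exchanges `h i j t` and `h i k t`, turning `⁅h i j v, h i k u⁆` into `⁅h i k v, h i j u⁆`. -/
theorem inv_symb {i j : ℕ} (h : i ≠ j) (u v : Rˣ) : (symb i j u v)⁻¹ = symb i j v u := by
  have hik : i ≠ i + j + 1 := by omega
  have hjk : j ≠ i + j + 1 := by omega
  set k := i + j + 1
  have h1 : (symb i j u v)⁻¹ = weyl j k 1 * (symb i j u v)⁻¹ * (weyl j k 1)⁻¹ := by
    rw [((symb_commute h u v (weyl j k 1)).inv_left).eq.symm, mul_inv_cancel_right]
  have h2 : ∀ g a b : SteinbergGroup R, g * ⁅a, b⁆ * g⁻¹ = ⁅g * a * g⁻¹, g * b * g⁻¹⁆ := by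
    intro g a b
    simp only [commutatorElement_def]
    group
  rw [h1, ← commutator_diag h hik hjk, commutatorElement_inv, h2,
    ← commutator_diag h hik hjk]
  have mi := isMonomialAt_weyl_of_ne hjk h hik (1 : Rˣ)
  have mj := isMonomialAt_weyl_left hjk (1 : Rˣ)
  have mk := isMonomialAt_weyl_right hjk (1 : Rˣ)
  have ml := isMonomialAt_weyl_of_ne (k := k + i + j + 1) hjk (by omega) (by omega) (1 : Rˣ)
  have key : ∀ (g : SteinbergGroup R) {j k : ℕ} {a : Rˣ} (t : Rˣ), i ≠ j → i ≠ k →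
      IsMonomialAt g i i 1 → IsMonomialAt g j k a → IsMonomialAt g (k + i + j + 1) (k + i + j + 1) 1 →
      toElementary R (g * diag i j t * g⁻¹) = toElementary R (diag i k t) := by
    intro g j k a t hij hik hi hj hl
    rw [diag, ← conj_mul, conj_weyl hi hj hl hij (by omega) (by omega) hik (by omega) (by omega),
      conj_weyl hi hj hl hij (by omega) (by omega) hik (by omega) (by omega)]
    simp only [one_mul, neg_mul]
    refine toElementary_eq_of_isMonomialAt fun l => ?_
    by_cases hi : l = i
    · subst hi
      refine ⟨_, _, ?_, isMonomialAt_diag_left hik t⟩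
      simpa using (isMonomialAt_weyl_right hik (t * a⁻¹)).mul (isMonomialAt_weyl_left hik (-a⁻¹))
    by_cases hj : l = k
    · subst hj
      refine ⟨_, _, ?_, isMonomialAt_diag_right hik t⟩
      simpa using (isMonomialAt_weyl_left hik (t * a⁻¹)).mul (isMonomialAt_weyl_right hik (-a⁻¹))
    · refine ⟨_, _, ?_, isMonomialAt_diag_of_ne hik hi hj t⟩
      simpa using (isMonomialAt_weyl_of_ne hik hi hj (t * a⁻¹)).mul
        (isMonomialAt_weyl_of_ne hik hi hj (-a⁻¹))
  refine commutator_congr (key _ v h hik mi mj ?_) (key _ u hik h mi mk ?_)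
  · exact isMonomialAt_weyl_of_ne hjk (by omega) (by omega) _
  · exact isMonomialAt_weyl_of_ne hjk (by omega) (by omega) _

theorem symb_mul_right {i j : ℕ} (h : i ≠ j) (u v v' : Rˣ) :
    symb i j u (v * v') = symb i j u v * symb i j u v' := by
  rw [← inv_symb h, symb_mul_left h, mul_inv_rev, inv_symb h, inv_symb h, (symb_commute h _ _ _).eq]

/-! ### Dennis–Stein elements -/

/-- The Dennis–Stein element of `St R` attached to `a`, `b` and a unit `d = 1 - a * b`. -/
noncomputable def dennisStein (i j : ℕ) (a b : R) (d : Rˣ) : SteinbergGroup R :=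
  elem j i (-((d⁻¹ : Rˣ) * b)) * elem i j (-a) * elem j i b * elem i j ((d⁻¹ : Rˣ) * a) *
    (diag i j d)⁻¹

/-- The four elementary factors multiply to the diagonal matrix with entries `d`, `d⁻¹`. Neither `a`
nor `b` has to be a unit, which makes these elements available over `R_c`. -/
theorem dennisStein_mem_K2 {i j : ℕ} (h : i ≠ j) {a b : R} {d : Rˣ} (hd : (d : R) = 1 - a * b) :
    dennisStein i j a b d ∈ K2 R := by
  change toElementary R _ = 1
  have hd' : (d : R) * (d⁻¹ : Rˣ) = 1 := d.mul_inv
  rw [hd] at hd'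
  rw [dennisStein, map_mul, map_inv, mul_inv_eq_one]
  ext v k
  have hdiag : toElementary R (diag i j d) v k =
      if k = i then d * v i else if k = j then (d⁻¹ : Rˣ) * v j else v k := by
    split_ifs with hi hj
    · subst hi; exact (isMonomialAt_diag_left h d).2 v
    · subst hj; exact (isMonomialAt_diag_right h d).2 v
    · simpa using (isMonomialAt_diag_of_ne h hi hj d).2 v
  rw [hdiag]
  simp only [map_mul, LinearEquiv.mul_apply, toElementary_elem h, toElementary_elem h.symm,
    Finsupp.add_apply, Finsupp.single_apply]
  by_cases hi : k = i
  · subst hi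
    simp [h, h.symm, hd]
    linear_combination a * v j * hd'
  by_cases hj : k = j
  · subst hj
    simp [h, h.symm]
    linear_combination (-b * v i + (-1 - a * b * (d⁻¹ : Rˣ)) * v k) * hd'
  · simp [hi, hj, Ne.symm hi, Ne.symm hj]

theorem map_weyl {S : Type*} [CommRing S] (f : R →+* S) (i j : ℕ) (u : Rˣ) :
    map f (weyl i j u) = weyl i j (Units.map (f : R →* S) u) := by
  simp [weyl]

theorem map_diag {S : Type*} [CommRing S] (f : R →+* S) (i j : ℕ) (u : Rˣ) :
    map f (diag i j u) = diag i j (Units.map (f : R →* S) u) := by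
  rw [diag, map_mul, map_weyl, map_weyl, diag]
  congr 2
  ext
  simp

theorem map_dennisStein {S : Type*} [CommRing S] (f : R →+* S) (i j : ℕ) (a b : R) (d : Rˣ) :
    map f (dennisStein i j a b d) =
      dennisStein i j (f a) (f b) (Units.map (f : R →* S) d) := by
  simp [dennisStein, map_diag]

theorem elem_eq_mul_weyl_mul {i j : ℕ} (u : Rˣ) :
    elem j i (-(u⁻¹ : Rˣ) : R) = elem i j (-u : R) * weyl i j u * elem i j (-u : R) := by
  rw [← elem_inv i j (u : R), weyl]
  group

/-- For a unit `b`, both factors `x j i` can be rewritten through Weyl elements. The `x i j` factors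
then cancel, and `w i j (b⁻¹ * d) * (w i j b⁻¹)⁻¹ = {b⁻¹, d} * h i j d` remains. -/
theorem dennisStein_eq_symb {i j : ℕ} (h : i ≠ j) {a : R} {b d : Rˣ}
    (hd : (d : R) = 1 - a * b) : dennisStein i j a (b : R) d = symb i j b⁻¹ d := by
  have hb' : (b : R) * (b⁻¹ : Rˣ) = 1 := b.mul_inv
  have hd' : (d : R) * (d⁻¹ : Rˣ) = 1 := d.mul_inv
  have e1 : elem j i (-((d⁻¹ : Rˣ) * b) : R) =
      elem i j (-(d * (b⁻¹ : Rˣ)) : R) * weyl i j (b⁻¹ * d) * elem i j (-(d * (b⁻¹ : Rˣ)) : R) := by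
    simpa [mul_comm] using elem_eq_mul_weyl_mul (i := i) (j := j) (b⁻¹ * d)
  have e2 : elem j i (b : R) =
      elem i j ((b⁻¹ : Rˣ) : R) * (weyl i j b⁻¹)⁻¹ * elem i j ((b⁻¹ : Rˣ) : R) := by
    simpa [weyl_inv] using elem_eq_mul_weyl_mul (i := i) (j := j) (-b⁻¹)
  have e3 : diag i j d * elem i j ((b⁻¹ : Rˣ) + (d⁻¹ : Rˣ) * a : R) * (diag i j d)⁻¹ =
      elem i j (d * (b⁻¹ : Rˣ) : R) := by
    rw [diag_conj_elem h]
    congr 1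
    linear_combination (d * (b⁻¹ : Rˣ) : R) * hd + (d * a) * hd' - (d * a) * hb'
  have e4 : elem i j (-(d * (b⁻¹ : Rˣ)) : R) * elem i j (-a) * elem i j ((b⁻¹ : Rˣ) : R) = 1 := by
    rw [elem_mul_elem, elem_mul_elem, ← elem_zero i j]
    congr 1
    linear_combination (-((b⁻¹ : Rˣ) : R)) * hd + a * hb'
  have e5 : weyl i j (b⁻¹ * d) * (weyl i j b⁻¹)⁻¹ = symb i j b⁻¹ d * diag i j d := by
    rw [symb, inv_mul_cancel_right, diag, diag]
    group
  calc dennisStein i j a (b : R) d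
      = elem i j (-(d * (b⁻¹ : Rˣ)) : R) * weyl i j (b⁻¹ * d) *
          (elem i j (-(d * (b⁻¹ : Rˣ)) : R) * elem i j (-a) * elem i j ((b⁻¹ : Rˣ) : R)) *
          (weyl i j b⁻¹)⁻¹ * (elem i j ((b⁻¹ : Rˣ) : R) * elem i j ((d⁻¹ : Rˣ) * a)) *
          (diag i j d)⁻¹ := by
        rw [dennisStein, e1, e2]
        group
    _ = elem i j (-(d * (b⁻¹ : Rˣ)) : R) * symb i j b⁻¹ d *
          (diag i j d * elem i j ((b⁻¹ : Rˣ) + (d⁻¹ : Rˣ) * a : R) * (diag i j d)⁻¹) := by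
        rw [e4, elem_mul_elem, mul_one, mul_assoc _ (weyl i j (b⁻¹ * d)), e5]
        group
    _ = symb i j b⁻¹ d := by
        rw [e3, (symb_commute h b⁻¹ d _).eq.symm, mul_assoc, elem_mul_elem, neg_add_cancel,
          elem_zero, mul_one]

/-- The subgroup of `St R` generated by all Steinberg symbols. -/
def symbols (R : Type*) [CommRing R] : Subgroup (SteinbergGroup R) :=
  Subgroup.closure {g | ∃ i j, ∃ u v : Rˣ, i ≠ j ∧ g = symb i j u v}

theorem symb_mem_symbols {i j : ℕ} (h : i ≠ j) (u v : Rˣ) : symb i j u v ∈ symbols R :=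
  Subgroup.subset_closure ⟨i, j, u, v, h, rfl⟩

theorem symbols_le_K2 : symbols R ≤ K2 R := by
  refine (Subgroup.closure_le _).2 ?_
  rintro _ ⟨i, j, u, v, h, rfl⟩
  exact toElementary_symb h u v

theorem symbols_commute {s : SteinbergGroup R} (hs : s ∈ symbols R) (g : SteinbergGroup R) :
    Commute s g :=
  K2_commute (symbols_le_K2 hs) g

/-- This and the next two lemmas say that, modulo symbols, the elements `w i j` and `h i j` multiply
like their matrices. -/
theorem exists_diag_mul_diag {i j : ℕ} (h : i ≠ j) (u v : Rˣ) :
    ∃ s ∈ symbols R, diag i j u * diag i j v = diag i j (u * v) * s :=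
  ⟨_, inv_mem (symb_mem_symbols h v u), by
    rw [diag_mul, ((symb_commute h v u _).inv_left).eq]⟩

theorem exists_weyl_mul_weyl {i j : ℕ} (h : i ≠ j) (u v : Rˣ) :
    ∃ s ∈ symbols R, weyl i j u * weyl i j v = diag i j (-u * v⁻¹) * s := by
  obtain ⟨s, hs, e⟩ := exists_diag_mul_diag h (-u * v⁻¹) (-v)
  refine ⟨s⁻¹, inv_mem hs, ?_⟩
  rw [show -u * v⁻¹ * -v = u by simp] at e
  rw [← (symbols_commute (inv_mem hs) _).eq, eq_inv_mul_iff_mul_eq, (symbols_commute hs _).eq]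
  have h1 : weyl i j u * weyl i j v = diag i j u * (diag i j (-v))⁻¹ := by
    rw [diag, diag, mul_inv_rev, weyl_inv i j (-v), neg_neg]
    group
  rw [h1, mul_assoc, ← (symbols_commute hs _).eq, ← mul_assoc, ← e, mul_inv_cancel_right]

theorem exists_weyl_mul_diag {i j : ℕ} (h : i ≠ j) (u v : Rˣ) :
    ∃ s ∈ symbols R, weyl i j u * diag i j v = weyl i j (u * v⁻¹) * s := by
  obtain ⟨s, hs, e⟩ := exists_weyl_mul_weyl h u v
  obtain ⟨s', hs', e'⟩ := exists_diag_mul_diag h (-u * v⁻¹) (-1)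
  rw [show -u * v⁻¹ * -1 = u * v⁻¹ by simp] at e'
  refine ⟨s' * s, mul_mem hs' hs, ?_⟩
  have h1 : ∀ t : Rˣ, weyl i j t = diag i j t * (weyl i j (-1))⁻¹ := by
    intro t
    rw [diag, mul_inv_cancel_right]
  have h2 : weyl i j (-1 : Rˣ) = diag i j (-1) * (weyl i j (-1))⁻¹ := h1 _
  calc weyl i j u * diag i j v = weyl i j u * weyl i j v * weyl i j (-1) := by
        rw [diag, mul_assoc]
    _ = diag i j (-u * v⁻¹) * (s * (diag i j (-1) * (weyl i j (-1))⁻¹)) := by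
        rw [e, ← h2, mul_assoc]
    _ = diag i j (u * v⁻¹) * (s' * (weyl i j (-1))⁻¹) * s := by
        rw [(symbols_commute hs _).eq, ← mul_assoc, ← mul_assoc, e']
        group
    _ = weyl i j (u * v⁻¹) * (s' * s) := by
        rw [(symbols_commute hs' _).eq, ← mul_assoc, ← h1, mul_assoc]

/-! ### Conjugation of generated subgroups by monomial elements -/

theorem conj_mem_of_mem_gen {I : ℕ → ℕ → Prop} {H : Subgroup (SteinbergGroup R)}
    {g x : SteinbergGroup R}
    (h : ∀ i j (r : R), I i j → i ≠ j → g * elem i j r * g⁻¹ ∈ H) (hx : x ∈ gen R I) :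
    g * x * g⁻¹ ∈ H := by
  refine gen_induction_left hx (by simp) ?_
  intro i j r y hI hij ih
  rw [← conj_mul]
  exact mul_mem (h i j r hI hij) ih

theorem IsMonomialAt.inv {g : SteinbergGroup R} {i i' : ℕ} {a : Rˣ}
    (h : IsMonomialAt g i i' a) : IsMonomialAt g⁻¹ i' i a⁻¹ := by
  constructor
  · rw [map_inv, LinearEquiv.coe_inv, LinearEquiv.symm_apply_eq, h.map_single]
    simp
  · intro v
    have := h.2 (toElementary R g⁻¹ v)
    rw [← LinearEquiv.mul_apply, ← map_mul, mul_inv_cancel, map_one] at this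
    change v i' = _ at this
    simp [this]

theorem exists_isMonomialAt_diag {i j : ℕ} (h : i ≠ j) (u : Rˣ) (k : ℕ) :
    ∃ a, IsMonomialAt (diag i j u) k k a := by
  by_cases hi : k = i
  · subst hi
    exact ⟨_, isMonomialAt_diag_left h u⟩
  by_cases hj : k = j
  · subst hj
    exact ⟨_, isMonomialAt_diag_right h u⟩
  · exact ⟨_, isMonomialAt_diag_of_ne h hi hj u⟩

/-- Diagonal elements normalize every subgroup generated by root subgroups. -/
theorem inv_diag_conj_mem_gen {i j : ℕ} (h : i ≠ j) (u : Rˣ) {I : ℕ → ℕ → Prop}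
    {x : SteinbergGroup R} (hx : x ∈ gen R I) :
    (diag i j u)⁻¹ * x * diag i j u ∈ gen R I := by
  have := conj_mem_of_mem_gen (g := (diag i j u)⁻¹) (H := gen R I) ?_ hx
  · rwa [inv_inv] at this
  intro k l r hI hkl
  obtain ⟨a, ha⟩ := exists_isMonomialAt_diag h u k
  obtain ⟨b, hb⟩ := exists_isMonomialAt_diag h u l
  obtain ⟨c, hc⟩ := exists_isMonomialAt_diag h u (k + l + 1)
  rw [conj_elem ha.inv hb.inv hc.inv hkl (by omega) (by omega) hkl (by omega) (by omega)]
  exact elem_mem_gen hI _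

end Ring

/-! ### Generation of `K₂` of a field by symbols -/

section Field

variable {K : Type*} [Field K]

/-- The subgroup generated by the `x i j r` with `i, j < n`. -/
abbrev level (K : Type*) [Field K] (n : ℕ) : Subgroup (SteinbergGroup K) :=
  gen K (fun i j => i < n ∧ j < n)

/-- The subgroup generated by the `x i j r` with `i < n`, `j ≤ n`. -/
abbrev upperParabolic (K : Type*) [Field K] (n : ℕ) : Subgroup (SteinbergGroup K) :=
  gen K (fun i j => i < n ∧ j ≤ n)

/-- The subgroup generated by the `x i j r` with `i ≤ n`, `j < n`, and the symbols. -/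
abbrev lowerParabolic (K : Type*) [Field K] (n : ℕ) : Subgroup (SteinbergGroup K) :=
  gen K (fun i j => i ≤ n ∧ j < n) ⊔ symbols K

theorem gen_le_lowerParabolic {n : ℕ} {I : ℕ → ℕ → Prop} (h : ∀ i j, I i j → i ≤ n ∧ j < n) :
    gen K I ≤ lowerParabolic K n :=
  (gen_mono h).trans le_sup_left

/-- Levi decomposition: the column subgroup is normalized by `level K n`. `exists_row_mul` is the
analogue for the lower parabolic. -/
theorem exists_column_mul {n : ℕ} {a : SteinbergGroup K} (ha : a ∈ upperParabolic K n) :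
    ∃ c ∈ column K n (Finset.range n), ∃ g ∈ level K n, a = c * g := by
  refine gen_induction_left ha ⟨1, one_mem _, 1, one_mem _, by simp⟩ ?_
  rintro i j r _ ⟨hi, hj⟩ hij ⟨c, hc, g, hg, rfl⟩
  rcases hj.lt_or_eq with hj | rfl
  · have hx : elem i j r ∈ level K n := elem_mem_gen ⟨hi, hj⟩ r
    exact ⟨_, conj_mem_column hx hc, _, mul_mem hx hg, by group⟩
  · exact ⟨elem i j r * c, mul_mem (elem_mem_gen ⟨by simpa, rfl⟩ r) hc, g, hg, by group⟩

theorem exists_row_mul {n : ℕ} {p : SteinbergGroup K} (hp : p ∈ lowerParabolic K n) :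
    ∃ c ∈ row K n (Finset.range n), ∃ g ∈ level K n, ∃ s ∈ symbols K, p = c * g * s := by
  have : (symbols K).Normal :=
    ⟨fun s hs g => by rwa [← (symbols_commute hs g).eq, mul_inv_cancel_right]⟩
  obtain ⟨q, hq, s, hs, rfl⟩ := Subgroup.mem_sup_of_normal_right.1 hp
  suffices ∃ c ∈ row K n (Finset.range n), ∃ g ∈ level K n, q = c * g by
    obtain ⟨c, hc, g, hg, rfl⟩ := this
    exact ⟨c, hc, g, hg, s, hs, rfl⟩
  refine gen_induction_left hq ⟨1, one_mem _, 1, one_mem _, by simp⟩ ?_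
  rintro i j r _ ⟨hi, hj⟩ hij ⟨c, hc, g, hg, rfl⟩
  rcases hi.lt_or_eq with hi | rfl
  · have hx : elem i j r ∈ level K n := elem_mem_gen ⟨hi, hj⟩ r
    exact ⟨_, conj_mem_row hx hc, _, mul_mem hx hg, by group⟩
  · exact ⟨elem i j r * c, mul_mem (elem_mem_gen ⟨rfl, by simpa⟩ r) hc, g, hg, by group⟩

theorem toElementary_upperParabolic_apply {n : ℕ} {a : SteinbergGroup K}
    (ha : a ∈ upperParabolic K n) (v : ℕ →₀ K) : toElementary K a v n = v n := by
  refine gen_induction_left ha (by simp) ?_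
  rintro i j r g ⟨hi, hj⟩ hij ih
  simp [toElementary_elem hij, ih, hi.ne]

theorem toElementary_lowerParabolic_single {n : ℕ} {p : SteinbergGroup K}
    (hp : p ∈ lowerParabolic K n) :
    toElementary K p (Finsupp.single n 1) = Finsupp.single n 1 := by
  obtain ⟨c, hc, g, hg, s, hs, rfl⟩ := exists_row_mul hp
  have hs' : toElementary K s = 1 := symbols_le_K2 hs
  have hg' : toElementary K g (Finsupp.single n 1) = Finsupp.single n 1 := by
    refine gen_induction_left hg (by simp) ?_
    rintro i j r g ⟨hi, hj⟩ hij ih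
    simp [toElementary_elem hij, ih, hj.ne']
  rw [map_mul, map_mul, hs', mul_one, LinearEquiv.mul_apply, hg',
    toElementary_row_single (by simp) (by simp) hc]

/-- The union of the two double cosets of the parabolic subgroups. -/
def bruhat (K : Type*) [Field K] (n : ℕ) (g : SteinbergGroup K) : Prop :=
  ∃ a ∈ upperParabolic K n, ∃ t : Kˣ, ∃ p ∈ lowerParabolic K n,
    g = a * diag n 0 t * p ∨ g = a * weyl n 0 t * p

theorem bruhat.mul_left {n : ℕ} {g a : SteinbergGroup K} (hg : bruhat K n g)
    (ha : a ∈ upperParabolic K n) : bruhat K n (a * g) := by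
  obtain ⟨b, hb, t, p, hp, h⟩ := hg
  refine ⟨a * b, mul_mem ha hb, t, p, hp, ?_⟩
  simpa only [mul_assoc, mul_right_inj] using h

theorem bruhat.mul_right {n : ℕ} {g p : SteinbergGroup K} (hg : bruhat K n g)
    (hp : p ∈ lowerParabolic K n) : bruhat K n (g * p) := by
  obtain ⟨a, ha, t, q, hq, h⟩ := hg
  refine ⟨a, ha, t, q * p, mul_mem hq hp, ?_⟩
  simpa only [← mul_assoc, mul_left_inj] using h

theorem bruhat_diag (n : ℕ) (t : Kˣ) : bruhat K n (diag n 0 t) :=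
  ⟨1, one_mem _, t, 1, one_mem _, by simp⟩

theorem bruhat_weyl (n : ℕ) (t : Kˣ) : bruhat K n (weyl n 0 t) :=
  ⟨1, one_mem _, t, 1, one_mem _, by simp⟩

/-- The rank one computation. If `1 + r * a = 0`, the product `x n 0 r * x 0 n a` is a Weyl element
up to a right factor `x n 0`. If `a` and `1 + r * a` are nonzero, a Dennis–Stein element, which is a
symbol here, interchanges the two unipotent factors. -/
theorem bruhat_elem_mul_elem_mul_diag {n : ℕ} (hn : 0 < n) (r a : K) (t : Kˣ) :
    bruhat K n (elem n 0 r * elem 0 n a * diag n 0 t) := by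
  have hn0 : n ≠ 0 := hn.ne'
  have hS : symbols K ≤ lowerParabolic K n := le_sup_right
  have hlow : ∀ r : K, (diag n 0 t)⁻¹ * elem n 0 r * diag n 0 t ∈ lowerParabolic K n := fun r =>
    le_sup_left (a := gen K (fun i j => i ≤ n ∧ j < n))
      (inv_diag_conj_mem_gen hn0 t (elem_mem_gen ⟨le_rfl, hn⟩ r))
  by_cases ha : a = 0
  · subst ha
    have := (bruhat_diag n t).mul_right (hlow r)
    simpa [mul_assoc] using this
  by_cases hd : 1 + r * a = 0
  · have hr : r ≠ 0 := by rintro rfl; simp at hd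
    obtain ⟨u, rfl⟩ : ∃ u : Kˣ, (u : K) = r := ⟨Units.mk0 r hr, rfl⟩
    have ha' : a = -((u⁻¹ : Kˣ) : K) := by
      have : (u : K) * (u⁻¹ : Kˣ) = 1 := u.mul_inv
      linear_combination ((u⁻¹ : Kˣ) : K) * hd - a * this
    obtain ⟨s, hs, e⟩ := exists_weyl_mul_diag hn0 u t
    have h1 := ((bruhat_weyl n (u * t⁻¹)).mul_right (hS hs)).mul_right (hlow (-u))
    have h2 : elem n 0 (u : K) * elem 0 n a * diag n 0 t =
        weyl n 0 (u * t⁻¹) * s * ((diag n 0 t)⁻¹ * elem n 0 (-u : K) * diag n 0 t) := by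
      rw [← e, weyl, ← ha', ← elem_inv]
      group
    rwa [h2]
  · obtain ⟨b, rfl⟩ : ∃ b : Kˣ, (b : K) = a := ⟨Units.mk0 a ha, rfl⟩
    obtain ⟨d, hd'⟩ : ∃ d : Kˣ, (d : K) = 1 + r * b := ⟨Units.mk0 _ hd, rfl⟩
    have h1 := dennisStein_eq_symb hn0 (a := -r) (b := b) (d := d) (by rw [hd']; ring)
    obtain ⟨s, hs, e⟩ := exists_diag_mul_diag hn0 d t
    have hsym := symb_mem_symbols hn0 b⁻¹ d
    have h2 : elem n 0 r * elem 0 n (b : K) * diag n 0 t =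
        elem 0 n ((d⁻¹ : Kˣ) * b : K) * (diag n 0 (d * t) * s * symb n 0 b⁻¹ d *
          ((diag n 0 t)⁻¹ * elem n 0 (-((d⁻¹ : Kˣ) * -r) : K) * diag n 0 t)) := by
      have hx : elem n 0 r * elem 0 n (b : K) = elem 0 n ((d⁻¹ : Kˣ) * b : K) * symb n 0 b⁻¹ d *
          diag n 0 d * elem n 0 (-((d⁻¹ : Kˣ) * -r) : K) := by
        rw [← h1, dennisStein, ← elem_inv 0 n, ← elem_inv n 0 ((d⁻¹ : Kˣ) * -r : K), neg_neg]
        group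
      rw [← e, ← (symbols_commute hsym (diag n 0 d * diag n 0 t)).eq, hx]
      group
    rw [h2]
    exact (((bruhat_diag n _).mul_right (hS hs)).mul_right (hS hsym)).mul_right (hlow _) |>.mul_left
      (elem_mem_gen ⟨hn, le_rfl⟩ _)

/-- The Weyl element exchanges the indices `0` and `n`. The generator `x n 0` is left out because it
would become `x 0 n`, outside the lower parabolic. -/
theorem inv_weyl_conj_mem {n : ℕ} (hn : 0 < n) (t : Kˣ) {x : SteinbergGroup K}
    (hx : x ∈ gen K (fun i j => i < n ∧ j = n ∨ i = n ∧ j ∈ Finset.Ico 1 n)) :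
    (weyl n 0 t)⁻¹ * x * weyl n 0 t ∈ lowerParabolic K n := by
  have hn0 : n ≠ 0 := hn.ne'
  have h0 := isMonomialAt_weyl_right hn0 (-t)
  have h1 := isMonomialAt_weyl_left hn0 (-t)
  have h2 : ∀ i, i ≠ n → i ≠ 0 → _ := fun i hi hi0 => isMonomialAt_weyl_of_ne hn0 hi hi0 (-t)
  have hk := h2 (n + 1) (by omega) (by omega)
  rw [weyl_inv, show weyl n 0 t = (weyl n 0 (-t))⁻¹ by rw [weyl_inv, neg_neg]]
  refine conj_mem_of_mem_gen (fun i j r hI hij => ?_) hx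
  refine gen_le_lowerParabolic (I := fun i j => i ≤ n ∧ j < n) (fun _ _ h => h) ?_
  rcases hI with ⟨hi, rfl⟩ | ⟨rfl, hj⟩
  · by_cases hi0 : i = 0
    · subst hi0
      rw [conj_elem h0 h1 hk (by omega) (by omega) (by omega) (by omega) (by omega) (by omega)]
      exact elem_mem_gen ⟨by omega, by omega⟩ _
    · rw [conj_elem (h2 i hij hi0) h1 hk (by omega) (by omega) (by omega) (by omega) (by omega)
        (by omega)]
      exact elem_mem_gen ⟨by omega, by omega⟩ _
  · rw [Finset.mem_Ico] at hj
    rw [conj_elem h1 (h2 j hij.symm (by omega)) hk (by omega) (by omega) (by omega) (by omega)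
      (by omega) (by omega)]
    exact elem_mem_gen ⟨by omega, by omega⟩ _

theorem bruhat_elem_mul_weyl {n : ℕ} (hn : 0 < n) (r : K) (t : Kˣ) :
    bruhat K n (elem n 0 r * weyl n 0 t) := by
  have hn0 : n ≠ 0 := hn.ne'
  by_cases hr : r = 0
  · simpa [hr] using bruhat_weyl n t
  obtain ⟨u, rfl⟩ : ∃ u : Kˣ, (u : K) = r := ⟨Units.mk0 r hr, rfl⟩
  obtain ⟨s, hs, e⟩ := exists_weyl_mul_weyl hn0 u t
  have h1 : elem n 0 (u : K) =
      elem 0 n ((u⁻¹ : Kˣ) : K) * weyl n 0 u * elem 0 n ((u⁻¹ : Kˣ) : K) := by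
    have := elem_eq_mul_weyl_mul (i := 0) (j := n) (-u⁻¹)
    rw [weyl_swap hn0.symm] at this
    simpa using this
  have h2 : elem n 0 (u : K) * weyl n 0 t = elem 0 n ((u⁻¹ : Kˣ) : K) *
      (diag n 0 (-u * t⁻¹) * s * ((weyl n 0 t)⁻¹ * elem 0 n ((u⁻¹ : Kˣ) : K) * weyl n 0 t)) := by
    rw [← e, h1]
    group
  rw [h2]
  exact (((bruhat_diag n _).mul_right (Subgroup.mem_sup_right hs)).mul_right
    (inv_weyl_conj_mem hn t (elem_mem_gen (Or.inl ⟨hn, rfl⟩) _))).mul_left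
    (elem_mem_gen ⟨hn, le_rfl⟩ _)

theorem range_eq_insert {n : ℕ} (hn : 0 < n) :
    Finset.range n = insert 0 (Finset.Ico 1 n) := by
  ext i
  simp
  omega

theorem elem_conj_mem_upperParabolic {n : ℕ} (r : K) {c : SteinbergGroup K}
    (hc : c ∈ column K n (Finset.Ico 1 n)) :
    elem n 0 r * c * (elem n 0 r)⁻¹ ∈ upperParabolic K n := by
  refine conj_mem_of_mem_gen ?_ hc
  rintro k l s ⟨hk, rfl⟩ hkl
  rw [Finset.mem_Ico] at hk
  rw [elem_conj_left hkl (by omega) (by omega)]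
  exact mul_mem (elem_mem_gen ⟨by omega, by omega⟩ _) (elem_mem_gen ⟨by omega, le_rfl⟩ _)

/-- In the diagonal coset, all of the column part except its `x 0 n` factor is conjugated into the
upper parabolic, leaving the rank one case. In the Weyl coset, `x n 0 r` is moved past the Levi
factor `g`; everything but one factor `x n 0 b` then passes through the Weyl element into the lower
parabolic. -/
theorem bruhat.elem_zero_mul {n : ℕ} (hn : 0 < n) {g : SteinbergGroup K} (hg : bruhat K n g)
    (r : K) : bruhat K n (elem n 0 r * g) := by
  have hn0 : n ≠ 0 := hn.ne'
  have hlev : level K n ≤ lowerParabolic K n := gen_le_lowerParabolic fun i j h => by omega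
  have hlev' : level K n ≤ upperParabolic K n := gen_mono fun i j h => by omega
  obtain ⟨a, ha, t, p, hp, rfl | rfl⟩ := hg
  · obtain ⟨c, hc, g, hg, rfl⟩ := exists_column_mul ha
    rw [range_eq_insert hn] at hc
    obtain ⟨c, hc', b, rfl⟩ := column_insert hn0.symm (by simp) hc
    have h1 := elem_conj_mem_upperParabolic r hc'
    have h2 := ((bruhat_elem_mul_elem_mul_diag hn r b t).mul_left h1).mul_right
      (mul_mem (hlev (inv_diag_conj_mem_gen hn0 t hg)) hp)
    convert h2 using 1
    group
  · obtain ⟨c, hc, g, hg, rfl⟩ := exists_column_mul ha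
    have hc' : g⁻¹ * c * g ∈ column K n (Finset.range n) := by
      simpa using conj_mem_column (inv_mem hg) hc
    have hr : g⁻¹ * elem n 0 r * g ∈ row K n (Finset.range n) := by
      simpa using conj_mem_row (inv_mem hg)
        (elem_mem_gen (R := K) (I := fun i j => i = n ∧ j ∈ Finset.range n) ⟨rfl, by simpa⟩ r)
    rw [range_eq_insert hn] at hr
    obtain ⟨b, ρ, hρ, e⟩ := row_insert hn0.symm (by simp) hr
    have h1 := inv_weyl_conj_mem hn t (gen_mono (I := fun i j => i ∈ Finset.range n ∧ j = n)
      (fun i j h => Or.inl ⟨Finset.mem_range.1 h.1, h.2⟩) hc')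
    have h2 := inv_weyl_conj_mem hn t (gen_mono (I := fun i j => i = n ∧ j ∈ Finset.Ico 1 n)
      (fun i j h => Or.inr h) hρ)
    have h3 := ((bruhat_elem_mul_weyl hn b t).mul_right (mul_mem h2 (mul_mem h1 hp))).mul_left
      (hlev' hg)
    have h4 : elem n 0 r = g * (elem n 0 b * ρ) * g⁻¹ := by
      rw [← e]
      group
    convert h3 using 1
    rw [h4]
    group

theorem bruhat_of_mem_level {n : ℕ} (hn : 0 < n) {g : SteinbergGroup K}
    (hg : g ∈ level K (n + 1)) : bruhat K n g := by
  refine gen_induction_left hg ?_ ?_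
  · simpa [diag_one] using bruhat_diag (K := K) n 1
  rintro i j r g ⟨hi, hj⟩ hij ih
  rcases (Nat.lt_succ_iff.1 hi).lt_or_eq with hi | rfl
  · exact ih.mul_left (elem_mem_gen ⟨hi, Nat.lt_succ_iff.1 hj⟩ r)
  by_cases hj0 : j = 0
  · subst hj0
    exact ih.elem_zero_mul hn r
  -- Writing `x n j r` as `⁅x n 0 r, x 0 j 1⁆` reduces to generators already treated.
  · rw [← mul_one r, ← elem_commutator hn.ne' (Ne.symm hj0) hij, commutatorElement_def, elem_inv,
      elem_inv, mul_assoc, mul_assoc, mul_assoc]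
    have hA : ∀ r : K, elem 0 j r ∈ upperParabolic K i := fun r => elem_mem_gen ⟨hn, by omega⟩ r
    exact (((ih.mul_left (hA _)).elem_zero_mul hn _).mul_left (hA _)).elem_zero_mul hn _

/-- Induction on the size. The upper parabolic preserves the `n`-th coordinate and the lower one
fixes the `n`-th basis vector, so the `(n, n)` entry of the matrix is `t` in the diagonal coset and
`0` in the Weyl coset. A trivial matrix forces the former with `t = 1`. The column and row parts are
then trivial, leaving an element of `level K n` times symbols. -/
theorem mem_symbols_of_mem_level {n : ℕ} {g : SteinbergGroup K} (hg : g ∈ level K n)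
    (h : toElementary K g = 1) : g ∈ symbols K := by
  induction n generalizing g with
  | zero =>
    refine gen_induction_left hg (one_mem _) ?_
    rintro i j r g ⟨hi, hj⟩
    omega
  | succ n ih =>
    rcases n.eq_zero_or_pos with rfl | hn
    · refine gen_induction_left hg (one_mem _) ?_
      rintro i j r g ⟨hi, hj⟩
      omega
    have hn0 : n ≠ 0 := hn.ne'
    have hlev : level K n ≤ lowerParabolic K n := gen_le_lowerParabolic fun i j h => by omega
    obtain ⟨a, ha, t, p, hp, e⟩ := bruhat_of_mem_level hn hg
    have hgn : toElementary K g (Finsupp.single n 1) = Finsupp.single n 1 := by rw [h]; rfl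
    have hgP : g ∈ lowerParabolic K n := by
      rcases e with rfl | rfl
      · have h1 := DFunLike.congr_fun hgn n
        rw [map_mul, LinearEquiv.mul_apply, toElementary_lowerParabolic_single hp, map_mul,
          LinearEquiv.mul_apply, toElementary_upperParabolic_apply ha,
          (isMonomialAt_diag_left hn0 t).1] at h1
        obtain rfl : t = 1 := by simpa using h1
        obtain ⟨c, hc, g', hg', rfl⟩ := exists_column_mul ha
        have hgp := mul_mem (hlev hg') hp
        rw [diag_one, mul_one, mul_assoc] at hgn ⊢
        rw [map_mul, LinearEquiv.mul_apply, toElementary_lowerParabolic_single hgp] at hgn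
        rwa [eq_one_of_mem_column (by simp) hc hgn, one_mul]
      · have h1 := DFunLike.congr_fun hgn n
        rw [map_mul, LinearEquiv.mul_apply, toElementary_lowerParabolic_single hp, map_mul,
          LinearEquiv.mul_apply, toElementary_upperParabolic_apply ha,
          (isMonomialAt_weyl_left hn0 t).1] at h1
        simp [hn0] at h1
    obtain ⟨c, hc, g', hg', s, hs, rfl⟩ := exists_row_mul hgP
    have hs' : toElementary K s = 1 := symbols_le_K2 hs
    rw [map_mul, hs', mul_one, map_mul] at h
    have hc1 : c = 1 := by
      refine eq_one_of_mem_row (by simp) hc fun j hj => ?_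
      rw [eq_inv_of_mul_eq_one_left h, ← map_inv, toElementary_upperParabolic_apply
        (gen_mono (I := fun i j => i < n ∧ j < n) (fun i j h => by omega) (inv_mem hg'))]
      have : j ≠ n := by rintro rfl; simp at hj
      simp [this]
    subst hc1
    rw [map_one, one_mul] at h
    rw [one_mul]
    exact mul_mem (ih hg' h) hs

/-- `K₂` of a field is generated by Steinberg symbols. -/
theorem K2_eq_symbols : K2 K = symbols K := by
  refine le_antisymm (fun g hg => ?_) symbols_le_K2
  obtain ⟨n, hn⟩ := exists_mem_gen g
  exact mem_symbols_of_mem_level hn hg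

end Field

/-! ### Bilinearity of symbols and powers -/

section Symbols

variable {R : Type*} [CommRing R]

theorem symb_one_left {i j : ℕ} (h : i ≠ j) (v : Rˣ) : symb i j 1 v = 1 := by
  have := symb_mul_left h 1 1 v
  rwa [mul_one, left_eq_mul] at this

theorem symb_inv_left {i j : ℕ} (h : i ≠ j) (u v : Rˣ) : symb i j u⁻¹ v = (symb i j u v)⁻¹ := by
  rw [eq_inv_iff_mul_eq_one, ← symb_mul_left h, inv_mul_cancel, symb_one_left h]

theorem symb_pow_right {i j : ℕ} (h : i ≠ j) (u v : Rˣ) (n : ℕ) :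
    symb i j u (v ^ n) = symb i j u v ^ n := by
  induction n with
  | zero => rw [pow_zero, pow_zero, ← inv_symb h, symb_one_left h, inv_one]
  | succ n ih => rw [pow_succ, pow_succ, symb_mul_right h, ih]

/-- The units `u` for which the `n`-th power of the symbol `{u, v}` lies in `H`. -/
noncomputable def symbolPreimage (H : Subgroup (SteinbergGroup R)) {i j : ℕ} (h : i ≠ j) (n : ℕ)
    (v : Rˣ) : Subgroup Rˣ where
  carrier := {u | symb i j u v ^ n ∈ H}
  one_mem' := by simp [symb_one_left h]
  mul_mem' := by
    intro a b ha hb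
    change (symb i j (a * b) v) ^ n ∈ H
    rw [symb_mul_left h, (symb_commute h a v _).mul_pow]
    exact mul_mem ha hb
  inv_mem' := by
    intro a ha
    change (symb i j a⁻¹ v) ^ n ∈ H
    rw [symb_inv_left h, inv_pow]
    exact inv_mem ha

theorem mem_symbolPreimage {H : Subgroup (SteinbergGroup R)} {i j : ℕ} {h : i ≠ j} {n : ℕ}
    {u v : Rˣ} : u ∈ symbolPreimage H h n v ↔ symb i j u v ^ n ∈ H :=
  Iff.rfl

theorem pow_mem_of_forall_symb {H : Subgroup (SteinbergGroup R)} {n : ℕ}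
    (hH : ∀ i j, i ≠ j → ∀ u v : Rˣ, symb i j u v ^ n ∈ H) {g : SteinbergGroup R}
    (hg : g ∈ symbols R) : g ^ n ∈ H := by
  induction hg using Subgroup.closure_induction with
  | mem x hx =>
    obtain ⟨i, j, u, v, h, rfl⟩ := hx
    exact hH i j h u v
  | one => simp
  | mul x y hx _ ihx ihy =>
    rw [(symbols_commute hx y).mul_pow]
    exact mul_mem ihx ihy
  | inv x _ ih =>
    rw [inv_pow]
    exact inv_mem ih

end Symbols

/-! ### Symbols coming from a subring -/

section Subring

variable {K : Type*} [Field K] (A : Subring K)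

/-- The image of `K₂ A` in `St K` for a subring `A` of `K`. -/
noncomputable def subringImage : Subgroup (SteinbergGroup K) :=
  (K2 A).map (map A.subtype)

variable {A}

theorem mem_range_map_of_mem_subringImage {α : K2 K} (h : (α : SteinbergGroup K) ∈ subringImage A) :
    α ∈ (K2.map A.subtype).range := by
  obtain ⟨g, hg, e⟩ := h
  exact ⟨⟨g, hg⟩, Subtype.ext e⟩

/-- The Dennis–Stein element is formed over `A`, where `b` may fail to be invertible, and becomes a
symbol only in `K`. -/
theorem symb_mem_subringImage {i j : ℕ} (h : i ≠ j) {a : K} {b d : Kˣ} (ha : a ∈ A)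
    (hb : (b : K) ∈ A) (hdA : (d : K) ∈ A) (hdA' : ((d⁻¹ : Kˣ) : K) ∈ A)
    (hd : (d : K) = 1 - a * b) : symb i j b⁻¹ d ∈ subringImage A := by
  let d' : Aˣ := ⟨⟨d, hdA⟩, ⟨_, hdA'⟩, Subtype.ext d.mul_inv, Subtype.ext d.inv_mul⟩
  refine ⟨dennisStein i j ⟨a, ha⟩ ⟨b, hb⟩ d', dennisStein_mem_K2 h (Subtype.ext hd), ?_⟩
  rw [map_dennisStein, ← dennisStein_eq_symb h hd]
  congr 1

end Subring

theorem exists_pow_sub_one_mem {O : Type*} [CommRing O] (I : Ideal O) [Finite (O ⧸ I)] :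
    ∃ n, 1 ≤ n ∧ Even n ∧ ∀ w : Oˣ, ((w ^ n : Oˣ) : O) - 1 ∈ I := by
  -- The factor `2` makes the exponent even, as needed to kill `{π, π}`.
  refine ⟨2 * Nat.card (O ⧸ I)ˣ, ?_, even_two_mul _, fun w => ?_⟩
  · have : 0 < Nat.card (O ⧸ I)ˣ := Nat.card_pos
    omega
  · have h1 : Units.map (Ideal.Quotient.mk I : O →* O ⧸ I) (w ^ (2 * Nat.card (O ⧸ I)ˣ)) = 1 := by
      rw [map_pow, mul_comm, pow_mul, pow_card_eq_one', one_pow]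
    rw [← Ideal.Quotient.eq_zero_iff_mem, map_sub, map_one, sub_eq_zero]
    exact congrArg Units.val h1

/-! ### Symbols over the fraction field of a discrete valuation ring -/

section ValuationRing

open IsLocalRing

variable {K : Type*} [Field K] {O : Type*} [CommRing O] [IsDomain O] [IsDiscreteValuationRing O]
  [Algebra O K] [IsFractionRing O K]

theorem subgroup_units_eq_top {P : Subgroup Kˣ} {ϖ : O} (hϖ : Irreducible ϖ) {π : Kˣ}
    (hπ : (π : K) = algebraMap O K ϖ) (hπP : π ∈ P)
    (hU : ∀ w : Oˣ, Units.map (algebraMap O K : O →* K) w ∈ P) : P = ⊤ := by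
  have key : ∀ (x : O) (u : Kˣ), (u : K) = algebraMap O K x → u ∈ P := by
    intro x u hu
    have hx : x ≠ 0 := by
      rintro rfl
      exact u.ne_zero (by rw [hu, map_zero])
    obtain ⟨n, w, rfl⟩ := IsDiscreteValuationRing.eq_unit_mul_pow_irreducible hx hϖ
    have : u = Units.map (algebraMap O K : O →* K) w * π ^ n := by
      ext
      simp [hu, hπ]
    rw [this]
    exact mul_mem (hU w) (pow_mem hπP n)
  refine eq_top_iff.2 fun u _ => ?_
  obtain ⟨x, y, hy, e⟩ := IsFractionRing.div_surjective (A := O) (u : K)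
  have hy0 : algebraMap O K y ≠ 0 := by simpa using nonZeroDivisors.ne_zero hy
  have hx0 : algebraMap O K x ≠ 0 := by
    intro h
    exact u.ne_zero (by rw [← e, h, zero_div])
  have : u = Units.mk0 _ hx0 * (Units.mk0 _ hy0)⁻¹ := by
    ext
    simp [← e, div_eq_mul_inv]
  rw [this]
  exact mul_mem (key x _ rfl) (inv_mem (key y _ rfl))

/-- The exponent `2 * c + 1` is what allows `1 - w = a * b` with `a, b ∈ 𝔪 ^ c` for `b` of either
valuation `c` or `c + 1`. Two consecutive valuations are needed so that quotients of such `b`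
include a uniformizer and all units. -/
theorem symb_mem_subringImage_of_sub_one_mem {A : Subring K} {c : ℕ}
    (hA : ∀ x ∈ maximalIdeal O ^ c, algebraMap O K x ∈ A) {i j : ℕ} (h : i ≠ j) {w : Oˣ}
    (hw : (w : O) - 1 ∈ maximalIdeal O ^ (2 * c + 1)) (y : Kˣ) :
    symb i j y (Units.map (algebraMap O K : O →* K) w) ∈ subringImage A := by
  obtain ⟨ϖ, hϖ⟩ := IsDiscreteValuationRing.exists_irreducible O
  have hm : ∀ n, maximalIdeal O ^ n = Ideal.span {ϖ ^ n} := fun n => by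
    rw [hϖ.maximalIdeal_eq, Ideal.span_singleton_pow]
  have hϖ0 : algebraMap O K ϖ ≠ 0 := by simpa using hϖ.ne_zero
  let π : Kˣ := Units.mk0 _ hϖ0
  obtain ⟨z, hz⟩ : ∃ z, (w : O) - 1 = ϖ ^ (2 * c + 1) * z := by
    rwa [hm, Ideal.mem_span_singleton] at hw
  set d := Units.map (algebraMap O K : O →* K) w
  have hwc : (w : O) - 1 ∈ maximalIdeal O ^ c := Ideal.pow_le_pow_right (by omega) hw
  have hdA : (d : K) ∈ A := by
    have := add_mem (hA _ hwc) A.one_mem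
    simpa [d] using this
  have hdA' : ((d⁻¹ : Kˣ) : K) ∈ A := by
    have h1 : (d : K) * (d⁻¹ : Kˣ) = 1 := d.mul_inv
    have := sub_mem A.one_mem (hA _ (Ideal.mul_mem_left _ ((w⁻¹ : Oˣ) : O) hwc))
    have e : ((d⁻¹ : Kˣ) : K) = algebraMap O K ((w⁻¹ : Oˣ) : O) := rfl
    have e' : (d : K) = algebraMap O K (w : O) := rfl
    rw [map_mul, map_sub, map_one, ← e, ← e'] at this
    convert this using 1
    linear_combination h1
  have key : ∀ n, c ≤ n → n ≤ c + 1 → ∀ v : Oˣ,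
      π ^ n * Units.map (algebraMap O K : O →* K) v ∈ symbolPreimage (subringImage A) h 1 d := by
    intro n hn hn' v
    -- The Dennis–Stein element yields `{b⁻¹, d}`, hence the passage to inverses.
    rw [← inv_mem_iff, mem_symbolPreimage, pow_one]
    refine symb_mem_subringImage h
      (a := algebraMap O K (-(ϖ ^ (2 * c + 1 - n) * z * (v⁻¹ : Oˣ)))) ?_ ?_ hdA hdA' ?_
    · refine hA _ (neg_mem (Ideal.mul_mem_right _ _ (Ideal.mul_mem_right _ _ ?_)))
      rw [hm, Ideal.mem_span_singleton]
      exact pow_dvd_pow _ (by omega)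
    · have := hA (ϖ ^ n * v) (Ideal.mul_mem_right _ _ ?_)
      · simpa [π] using this
      · rw [hm, Ideal.mem_span_singleton]
        exact pow_dvd_pow _ hn
    · have e : (w : O) = 1 - -(ϖ ^ (2 * c + 1 - n) * z * (v⁻¹ : Oˣ)) * (ϖ ^ n * v) := by
        have h1 : ϖ ^ (2 * c + 1) = ϖ ^ (2 * c + 1 - n) * ϖ ^ n := by
          rw [← pow_add]
          congr 1
          omega
        have h2 : (v : O) * (v⁻¹ : Oˣ) = 1 := v.mul_inv
        rw [h1] at hz
        linear_combination hz - ϖ ^ (2 * c + 1 - n) * ϖ ^ n * z * h2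
      have := congrArg (algebraMap O K) e
      simpa [π, d] using this
  have htop := subgroup_units_eq_top (P := symbolPreimage (subringImage A) h 1 d) hϖ (π := π) rfl
    ?_ ?_
  · have : y ∈ symbolPreimage (subringImage A) h 1 d := htop ▸ Subgroup.mem_top y
    rwa [mem_symbolPreimage, pow_one] at this
  · have := mul_mem (key (c + 1) (by omega) le_rfl 1) (inv_mem (key c le_rfl (by omega) 1))
    simpa [pow_succ] using this
  · intro v
    have := mul_mem (key c le_rfl (by omega) v) (inv_mem (key c le_rfl (by omega) 1))
    simpa [mul_comm, mul_assoc] using this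

/-- Divisible elements of `K₂` of the fraction field of a discrete valuation ring with finite
residue rings come from every subring containing a power of the maximal ideal. -/
theorem mem_range_of_isDivisibleElement {A : Subring K} {c : ℕ}
    (hA : ∀ x ∈ maximalIdeal O ^ c, algebraMap O K x ∈ A)
    [Finite (O ⧸ maximalIdeal O ^ (2 * c + 1))] {α : K2 K} (hα : IsDivisibleElement α) :
    α ∈ (K2.map A.subtype).range := by
  obtain ⟨n, hn, ⟨m, hm⟩, hpow⟩ := exists_pow_sub_one_mem (maximalIdeal O ^ (2 * c + 1))
  obtain ⟨β, rfl⟩ := hα n hn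
  apply mem_range_map_of_mem_subringImage
  rw [Subgroup.coe_pow]
  have hβ : (β : SteinbergGroup K) ∈ symbols K := K2_eq_symbols (K := K) ▸ β.2
  refine pow_mem_of_forall_symb (fun i j h => ?_) hβ
  obtain ⟨ϖ, hϖ⟩ := IsDiscreteValuationRing.exists_irreducible O
  have hϖ0 : algebraMap O K ϖ ≠ 0 := by simpa using hϖ.ne_zero
  set π : Kˣ := Units.mk0 _ hϖ0
  have hunit' : ∀ (w : Oˣ) (y : Kˣ),
      symb i j y (Units.map (algebraMap O K : O →* K) w) ^ n ∈ subringImage A := by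
    intro w y
    rw [← symb_pow_right h, ← map_pow]
    exact symb_mem_subringImage_of_sub_one_mem hA h (hpow w) y
  have hunit : ∀ (w : Oˣ) (y : Kˣ),
      symb i j (Units.map (algebraMap O K : O →* K) w) y ^ n ∈ subringImage A := by
    intro w y
    rw [← inv_symb h, inv_pow]
    exact inv_mem (hunit' w y)
  -- Antisymmetry gives `{π, π} ^ 2 = 1`, and `n` is even.
  have hππ : symb i j π π ^ n ∈ subringImage A := by
    have : symb i j π π * symb i j π π = 1 := by
      rw [mul_eq_one_iff_eq_inv, inv_symb h]
    rw [hm, ← two_mul, pow_mul, pow_two, this, one_pow]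
    exact one_mem _
  -- Bilinearity is used one variable at a time: first with `π` in the second slot, then, by
  -- antisymmetry, with arbitrary `v`.
  have h1 : symbolPreimage (subringImage A) h n π = ⊤ :=
    subgroup_units_eq_top hϖ (π := π) rfl hππ fun w => hunit w π
  intro u v
  have h2 : symbolPreimage (subringImage A) h n v = ⊤ := by
    refine subgroup_units_eq_top hϖ (π := π) rfl ?_ fun w => hunit w v
    rw [mem_symbolPreimage, ← inv_symb h, inv_pow]
    have : v ∈ symbolPreimage (subringImage A) h n π := h1 ▸ Subgroup.mem_top v
    exact inv_mem this
  exact mem_symbolPreimage.1 (h2 ▸ Subgroup.mem_top u)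

end ValuationRing

end SteinbergGroup

/-! ### The ring of integers as a discrete valuation ring with finite quotients -/

namespace LocalOrder

variable (p : ℕ) [Fact p.Prime] (F : Type*) [Field F] [Algebra ℚ_[p] F] [Algebra ℤ_[p] F]
  [IsScalarTower ℤ_[p] ℚ_[p] F]

theorem faithfulSMul_ringOfIntegers : FaithfulSMul ℤ_[p] (ringOfIntegers p F) := by
  rw [faithfulSMul_iff_algebraMap_injective]
  have h : Function.Injective (algebraMap ℤ_[p] F) := by
    rw [IsScalarTower.algebraMap_eq ℤ_[p] ℚ_[p] F]
    exact (algebraMap ℚ_[p] F).injective.comp (IsFractionRing.injective ℤ_[p] ℚ_[p])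
  exact fun x y hxy => h (congrArg Subtype.val hxy)

variable [FiniteDimensional ℚ_[p] F]

theorem finite_ringOfIntegers : Module.Finite ℤ_[p] (ringOfIntegers p F) :=
  IsIntegralClosure.finite ℤ_[p] ℚ_[p] F (ringOfIntegers p F)

theorem isFractionRing_ringOfIntegers : IsFractionRing (ringOfIntegers p F) F :=
  integralClosure.isFractionRing_of_finite_extension ℚ_[p] F

/-- `𝒪_F` is a local Dedekind domain. It is not a field, since by integrality `ℤ_[p]` would then be
one too. -/
theorem isDiscreteValuationRing_ringOfIntegers :
    IsDiscreteValuationRing (ringOfIntegers p F) := by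
  have hD : IsDedekindDomain (ringOfIntegers p F) := integralClosure.isDedekindDomain ℤ_[p] ℚ_[p] F
  have := faithfulSMul_ringOfIntegers p F
  have hfield : ¬IsField (ringOfIntegers p F) := fun h =>
    IsDiscreteValuationRing.not_isField ℤ_[p] (isField_of_isIntegral_of_isField
      (FaithfulSMul.algebraMap_injective ℤ_[p] (ringOfIntegers p F)) h)
  exact ((IsDiscreteValuationRing.TFAE (ringOfIntegers p F) hfield).out 0 2).2 hD

theorem finite_quotient_maximalIdeal_pow (n : ℕ) :
    Finite (ringOfIntegers p F ⧸ IsLocalRing.maximalIdeal (ringOfIntegers p F) ^ n) := by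
  have := finite_ringOfIntegers p F
  have := faithfulSMul_ringOfIntegers p F
  have := isDiscreteValuationRing_ringOfIntegers p F
  have : Finite (IsLocalRing.ResidueField ℤ_[p]) := .of_equiv _ PadicInt.residueField.symm.toEquiv
  have : Finite (ringOfIntegers p F ⧸ IsLocalRing.maximalIdeal (ringOfIntegers p F)) :=
    IsLocalRing.ResidueField.finite_of_finite (R := ℤ_[p]) this
  exact Ideal.finite_quotient_pow (IsNoetherian.noetherian _) n

end LocalOrder

theorem lemma4p12 (p : ℕ) [Fact p.Prime] (F : Type*) [Field F] [Algebra ℚ_[p] F]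
    [FiniteDimensional ℚ_[p] F] [Algebra ℤ_[p] F] [IsScalarTower ℤ_[p] ℚ_[p] F]
    (α : K2 F) (hα : IsDivisibleElement α) (c : ℕ) :
    α ∈ (K2.map (LocalOrder.R p F c).subtype).range := by
  have := LocalOrder.isDiscreteValuationRing_ringOfIntegers p F
  have := LocalOrder.isFractionRing_ringOfIntegers p F
  have := LocalOrder.finite_quotient_maximalIdeal_pow p F (2 * c + 1)
  -- Elements of `𝔪 ^ c` lie in `R_c` with zero component in `𝒪_0`.
  have hR : ∀ x ∈ IsLocalRing.maximalIdeal (LocalOrder.ringOfIntegers p F) ^ c,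
      algebraMap (LocalOrder.ringOfIntegers p F) F x ∈ LocalOrder.R p F c := fun x hx =>
    ⟨0, x, hx, by rw [map_zero, ZeroMemClass.coe_zero, zero_add]; rfl⟩
  exact SteinbergGroup.mem_range_of_isDivisibleElement hR hα
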